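/- Let $0<m<n$ be integers. Let $P=\bigoplus_{a=0}^n\mathbb Z e_a$ with the symmetric bilinear form $\langle \sum x_ae_a,\sum y_ae_a\rangle=-(m-2)x_0y_0+\sum_{a=1}^n x_ay_a$, and put $\alpha_0=e_0-e_1-\cdots-e_m$, $\alpha_i=e_i-e_{i+1}$ ($1\le i\le n-1$). Let $W_{m,n}=\langle s_0,\dots,s_{n-1}\rangle$ be the Coxeter group of the Dynkin diagram consisting of the chain $1-2-\cdots-(n-1)$ and a further vertex $0$ joined to $m$; it acts on $P$ by $s_i(\Lambda)=\Lambda-\langle\alpha_i,\Lambda\rangle\alpha_i$. Let $M=W_{m,n}.e_1\subset P$. Let $K$ be the field of meromorphic functions of $(\varepsilon_0,\dots,\varepsilon_n)\in\mathbb C^{n+1}$. An element $\sum_a x_ae_a$ of $P$ is also read as the linear form $\sum_a x_a\varepsilon_a$, and $s_i$ acts on $K$ by the substitution $\varepsilon_a\mapsto$ (linear form of $s_i(e_a)$), $0\le a\le n$. Fix $\omega$ in the upper half plane and let $[x]=\vartheta_{11}(x)=\sum_{k\in\mathbb Z}\exp\big(\pi i(k+\tfrac12)^2\omega+2\pi i(k+\tfrac12)(x+\tfrac12)\big)$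 be the odd theta function. Let $K(f,\tau)$ be the field of rational functions over $K$ in indeterminates $f_1,\dots,f_m,\tau_1,\dots,\tau_n$. There is a unique action of $W_{m,n}$ on $K(f,\tau)$ by field automorphisms that extends the above action of the $s_i$ on $K$ and satisfies: * $s_0(\tau_a)=f_a\tau_a$ $(1\le a\le m)$ and $s_0(\tau_a)=\tau_a$ $(m<a\le n)$; for $1\le i\le n-1$, $s_i$ interchanges $\tau_i$ and $\tau_{i+1}$ and fixes the other $\tau_a$; * $s_0(f_a)=1/f_a$ $(1\le a\le m)$; for $1\le i\le m-1$, $s_i$ interchanges $f_i$ and $f_{i+1}$ and fixes the other $f_a$; $s_m(f_a)=\frac{\tau_m}{\tau_{m+1}}(c_{a,m}f_a+c_{m,a}f_m)$ $(1\le a\le m-1)$, $s_m(f_m)=\frac{\tau_m}{\tau_{m+1}}f_m$; for $m<i\le n-1$, $s_i$ fixes all $f_a$; here $$c_{a,b}=\frac{[\varepsilon_a-\varepsilon_{m+1}]\,[\alpha_0+\varepsilon_b-\varepsilon_{m+1}]}{[\varepsilon_a-\varepsilon_b]\,[\alpha_0]}.$$ For $\Lambda\in M$ choose $w\in W_{m,n}$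 with $w.e_1=\Lambda$ and put $\tau(\Lambda)=w(\tau_1)$. This is independent of the choice of $w$; moreover $e_a\in M$ and $\tau(e_a)=\tau_a$ for $1\le a\le n$. If $m\ge 2$, then for any mutually distinct indices $1\le i,j,k,l_1,\dots,l_{m-2}\le n$ and $L=e_0-e_{l_1}-\cdots-e_{l_{m-2}}$, the vectors $L-e_i,L-e_j,L-e_k$ lie in $M$ and $$\begin{aligned}&[\varepsilon_j-\varepsilon_k]\,[L-\varepsilon_j-\varepsilon_k]\,\tau(e_i)\,\tau(L-e_i)\\ {}+{}&[\varepsilon_k-\varepsilon_i]\,[L-\varepsilon_k-\varepsilon_i]\,\tau(e_j)\,\tau(L-e_j)\\ {}+{}&[\varepsilon_i-\varepsilon_j]\,[L-\varepsilon_i-\varepsilon_j]\,\tau(e_k)\,\tau(L-e_k)=0.\end{aligned}$$ -/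

import Mathlib

namespace EllipticTau

noncomputable section

/-! ### The lattice, its metric and the simple roots -/

/-- The lattice `P = ℤ e₀ ⊕ ℤ e₁ ⊕ ⋯ ⊕ ℤ eₙ`. -/
abbrev Lat (n : ℕ) : Type := Fin (n + 1) → ℤ

/-- The basis vector `e_a`, `0 ≤ a ≤ n`. -/
def e {n : ℕ} (a : Fin (n + 1)) : Lat n := Pi.single a 1

/-- The metric `⟨x, y⟩ = -(m - 2) x₀ y₀ + ∑_{a = 1}^n x_a y_a`. -/
def metric (m : ℕ) {n : ℕ} (x y : Lat n) : ℤ :=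
  -((m : ℤ) - 2) * x 0 * y 0 + ∑ a : Fin n, x a.succ * y a.succ

/-- The simple roots: `α₀ = e₀ - e₁ - ⋯ - e_m` and `α_i = e_i - e_{i+1}` for `1 ≤ i ≤ n - 1`. -/
def root (m : ℕ) {n : ℕ} (i : Fin n) : Lat n :=
  if (i : ℕ) = 0 then e 0 - ∑ a ∈ Finset.univ.filter (fun a : Fin n => (a : ℕ) < m), e a.succ
  else e i.castSucc - e i.succ

theorem metric_comm (m : ℕ) {n : ℕ} (x y : Lat n) : metric m x y = metric m y x := by
  simp only [metric, mul_comm, mul_left_comm]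

theorem metric_add (m : ℕ) {n : ℕ} (x y z : Lat n) :
    metric m x (y + z) = metric m x y + metric m x z := by
  simp only [metric, Pi.add_apply, mul_add, Finset.sum_add_distrib]
  ring

theorem metric_smul (m : ℕ) {n : ℕ} (c : ℤ) (x y : Lat n) :
    metric m x (c • y) = c * metric m x y := by
  simp only [metric, Pi.smul_apply, smul_eq_mul, mul_add, Finset.mul_sum]
  congr 1
  · ring
  · exact Finset.sum_congr rfl fun _ _ => by ring

/-- The reflection `s_i(Λ) = Λ - ⟨α_i, Λ⟩ α_i` on the lattice. -/
def refl (m : ℕ) {n : ℕ} (i : Fin n) : Module.End ℤ (Lat n) where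
  toFun x := x - metric m (root m i) x • root m i
  map_add' x y := by rw [metric_add, add_smul]; abel
  map_smul' c x := by
    rw [metric_smul, RingHom.id_apply, smul_sub, mul_smul]

/-! ### The Weyl group -/

/-- Adjacency in the Dynkin diagram of `W_{m,n}`: the chain `1 - 2 - ⋯ - (n-1)`, together with
the vertex `0` attached to the vertex `m`. -/
def Adjacent (m : ℕ) {n : ℕ} (i j : Fin n) : Prop :=
  ((i : ℕ) ≠ 0 ∧ (j : ℕ) ≠ 0 ∧ ((i : ℕ) + 1 = j ∨ (j : ℕ) + 1 = i)) ∨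
    ((i : ℕ) = 0 ∧ (j : ℕ) = m) ∨ ((i : ℕ) = m ∧ (j : ℕ) = 0)

instance (m : ℕ) {n : ℕ} (i j : Fin n) : Decidable (Adjacent m i j) := by
  unfold Adjacent; infer_instance

/-- The Coxeter matrix attached to the Dynkin diagram. -/
def cox (m n : ℕ) : CoxeterMatrix (Fin n) where
  M := Matrix.of fun i j => if i = j then 1 else if Adjacent m i j then 3 else 2
  isSymm := Matrix.IsSymm.ext fun i j => by
    have h : Adjacent m j i ↔ Adjacent m i j := by unfold Adjacent; tauto
    simp only [Matrix.of_apply, h, eq_comm (a := j)]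
  diagonal i := by simp
  off_diagonal i j h := by
    simp only [Matrix.of_apply, h, if_false]
    split_ifs <;> decide

/-- The Weyl group `W_{m,n}`: the Coxeter group of the Dynkin diagram. -/
abbrev Weyl (m n : ℕ) : Type := (cox m n).Group

/-- The Coxeter system of `W_{m,n}`; its simple reflections are `s₀, …, s_{n-1}`. -/
abbrev cs (m n : ℕ) : CoxeterSystem (cox m n) (Weyl m n) := (cox m n).toCoxeterSystem

theorem metric_e_zero (m : ℕ) {n : ℕ} (x : Lat n) :
    metric m x (e 0) = -((m : ℤ) - 2) * x 0 := by
  simp [metric, e]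

theorem metric_e_succ (m : ℕ) {n : ℕ} (x : Lat n) (a : Fin n) :
    metric m x (e a.succ) = x a.succ := by
  simp [metric, e, Pi.single_apply]

theorem metric_e_of_ne (m : ℕ) {n : ℕ} (x : Lat n) (b : Fin (n + 1)) (hb : b ≠ 0) :
    metric m x (e b) = x b := by
  obtain ⟨a, rfl⟩ := Fin.exists_succ_eq.mpr hb
  exact metric_e_succ m x a

theorem metric_sub (m : ℕ) {n : ℕ} (x y z : Lat n) :
    metric m x (y - z) = metric m x y - metric m x z := by
  have h := metric_add m x (y - z) z
  rw [sub_add_cancel] at h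
  omega

theorem metric_sum (m : ℕ) {n : ℕ} (x : Lat n) (s : Finset (Fin n)) (y : Fin n → Lat n) :
    metric m x (∑ a ∈ s, y a) = ∑ a ∈ s, metric m x (y a) := by
  induction s using Finset.cons_induction with
  | empty => simp [metric]
  | cons a s ha ih => rw [Finset.sum_cons, Finset.sum_cons, metric_add, ih]

theorem root_zero_apply_zero (m : ℕ) {n : ℕ} (i : Fin n) (hi : (i : ℕ) = 0) :
    (root m i : Lat n) 0 = 1 := by
  simp only [root, hi, if_true, e, Pi.sub_apply, Finset.sum_apply, Pi.single_apply,
    (Fin.succ_ne_zero _).symm, if_false, Finset.sum_const_zero, sub_zero]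

theorem root_zero_apply_succ (m : ℕ) {n : ℕ} (i a : Fin n) (hi : (i : ℕ) = 0) :
    (root m i : Lat n) a.succ = if (a : ℕ) < m then -1 else 0 := by
  simp only [root, hi, if_true, e, Pi.sub_apply, Finset.sum_apply, Pi.single_apply,
    Fin.succ_ne_zero, if_false, Fin.succ_inj, Finset.sum_ite_eq, Finset.mem_filter,
    Finset.mem_univ, true_and]
  split_ifs <;> rfl

theorem root_pos_apply (m : ℕ) {n : ℕ} (i : Fin n) (hi : (i : ℕ) ≠ 0) (b : Fin (n + 1)) :
    (root m i : Lat n) b =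
      (if (b : ℕ) = i then 1 else 0) - (if (b : ℕ) = i + 1 then 1 else 0) := by
  simp only [root, hi, if_false, e, Pi.sub_apply, Pi.single_apply, Fin.ext_iff, Fin.val_castSucc,
    Fin.val_succ]

theorem metric_root_pos (m : ℕ) {n : ℕ} (x : Lat n) (j : Fin n) (hj : (j : ℕ) ≠ 0) :
    metric m x (root m j) = x j.castSucc - x j.succ := by
  have h : j.castSucc ≠ 0 := by
    intro h
    exact hj (by simpa [Fin.ext_iff] using h)
  simp only [root, hj, if_false]
  rw [metric_sub, metric_e_of_ne m x _ h, metric_e_succ]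

theorem metric_root (m : ℕ) {n : ℕ} (hmn : m < n) (i j : Fin n) :
    metric m (root m i) (root m j) = if i = j then 2 else if Adjacent m i j then -1 else 0 := by
  have zero_pos : ∀ i j : Fin n, (i : ℕ) = 0 → (j : ℕ) ≠ 0 →
      metric m (root m i) (root m j) = if (j : ℕ) = m then -1 else 0 := by
    intro i j hi hj
    have hc : j.castSucc = (⟨j - 1, by omega⟩ : Fin n).succ := by
      ext; simp; omega
    rw [metric_root_pos m _ j hj, hc, root_zero_apply_succ m i _ hi, root_zero_apply_succ m i _ hi]
    simp only
    split_ifs <;> omega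
  by_cases hi : (i : ℕ) = 0
  · by_cases hj : (j : ℕ) = 0
    · have hij : i = j := Fin.ext (by omega)
      subst hij
      have hr : root m i = (e 0 - ∑ a ∈ Finset.univ.filter (fun a : Fin n => (a : ℕ) < m), e a.succ : Lat n) := by
        simp only [root, hi, if_true]
      conv_lhs => arg 3; rw [hr]
      rw [metric_sub, metric_e_zero, metric_sum, root_zero_apply_zero m i hi]
      have hs : ∑ a ∈ Finset.univ.filter (fun a : Fin n => (a : ℕ) < m), metric m (root m i) (e a.succ) = -(m : ℤ) := by
        rw [Finset.sum_congr rfl (g := fun _ => (-1 : ℤ))]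
        · have hcard : (Finset.univ.filter fun a : Fin n => (a : ℕ) < m).card = m := by
            have h := Fin.card_filter_val_lt (n := n) (m := m)
            rw [h]; omega
          rw [Finset.sum_const, hcard]; simp
        · intro a ha
          rw [metric_e_succ, root_zero_apply_succ m i a hi, if_pos (Finset.mem_filter.mp ha).2]
      rw [hs]; simp
    · rw [zero_pos i j hi hj]
      have hij : i ≠ j := fun h => hj (h ▸ hi)
      have hA : Adjacent m i j ↔ (j : ℕ) = m := by unfold Adjacent; omega
      simp only [hij, if_false, hA]
  · by_cases hj : (j : ℕ) = 0
    · rw [metric_comm, zero_pos j i hj hi]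
      have hij : i ≠ j := fun h => hi (h ▸ hj)
      have hA : Adjacent m i j ↔ (i : ℕ) = m := by unfold Adjacent; omega
      simp only [hij, if_false, hA]
    · rw [metric_root_pos m _ j hj, root_pos_apply m i hi, root_pos_apply m i hi]
      have hij : i = j ↔ (i : ℕ) = j := Fin.ext_iff
      have hA : Adjacent m i j ↔ ((i : ℕ) + 1 = j ∨ (j : ℕ) + 1 = i) := by
        unfold Adjacent; omega
      simp only [hij, hA, Fin.val_castSucc, Fin.val_succ]
      split_ifs <;> omega

theorem refl_liftable (m : ℕ) {n : ℕ} (hmn : m < n) :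
    (cox m n).IsLiftable (refl m : Fin n → Module.End ℤ (Lat n)) := by
  intro i j
  have key := metric_root m hmn
  have h1 := key i i
  have h2 := key j j
  have h3 := key i j
  have h4 := key j i
  have hc : (cox m n).M i j = if i = j then 1 else if Adjacent m i j then 3 else 2 := rfl
  rw [metric_comm m (root m j)] at h4
  rw [hc]
  simp only [if_true] at h1 h2
  by_cases hij : i = j
  · subst hij
    simp only [if_true, pow_one]
    refine LinearMap.ext fun x => ?_
    simp only [Module.End.mul_apply, refl, LinearMap.coe_mk, AddHom.coe_mk, Module.End.one_apply,
      sub_eq_add_neg, ← neg_smul, metric_add, metric_smul, h1]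
    module
  · simp only [hij, if_false] at h3 ⊢
    have h3' := h3
    rw [metric_comm] at h3'
    split_ifs at h3 h3' ⊢
    all_goals
      refine LinearMap.ext fun x => ?_
      simp only [pow_succ, pow_zero, one_mul, Module.End.mul_apply, refl, LinearMap.coe_mk,
        AddHom.coe_mk, Module.End.one_apply,
        sub_eq_add_neg, ← neg_smul, metric_add, metric_smul, h1, h2, h3, h3']
      module

/-- The action of `W_{m,n}` on the lattice `P`, in which `s_i` acts as the reflection in `α_i`. -/
def latAction (m : ℕ) {n : ℕ} (hmn : m < n) : Weyl m n →* Module.End ℤ (Lat n) :=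
  (cs m n).lift ⟨refl m, refl_liftable m hmn⟩

/-- The index `1` of the vector `e₁`, as an element of `{1, …, n}` (elements of `Fin n` number the
points, the element `a` standing for the index `a + 1`). -/
def first {m n : ℕ} (hmn : m < n) : Fin n := ⟨0, by omega⟩

/-- The orbit `M = W_{m,n}.e₁`. -/
def orbit (m : ℕ) {n : ℕ} (hmn : m < n) : Set (Lat n) :=
  {Λ | ∃ w : Weyl m n, latAction m hmn w (e (first hmn).succ) = Λ}

/-! ### Meromorphic functions of `(ε₀, …, εₙ)` -/

/-- The ring of entire functions of `(ε₀, …, εₙ) ∈ ℂ^{n+1}`. -/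
def Entire (n : ℕ) : Subring ((Fin (n + 1) → ℂ) → ℂ) where
  carrier := {g | AnalyticOnNhd ℂ g Set.univ}
  mul_mem' hf hg := AnalyticOnNhd.mul hf hg
  one_mem' := analyticOnNhd_const
  add_mem' hf hg := AnalyticOnNhd.add hf hg
  zero_mem' := analyticOnNhd_const
  neg_mem' hf := AnalyticOnNhd.neg hf

instance (n : ℕ) : IsDomain (Entire n) := by
  have : NoZeroDivisors (Entire n) := by
    refine ⟨fun {f g} h => ?_⟩
    by_contra hne
    push Not at hne
    obtain ⟨hf, hg⟩ := hne
    obtain ⟨x, hx⟩ : ∃ x, f.1 x ≠ 0 := by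
      by_contra hx
      push Not at hx
      exact hf (Subtype.ext (funext hx))
    have hc : ∀ᶠ y in nhds x, f.1 y ≠ 0 := (f.2 x (Set.mem_univ x)).continuousAt.eventually_ne hx
    have hg0 : g.1 =ᶠ[nhds x] 0 := by
      filter_upwards [hc] with y hy
      have h2 : f.1 y * g.1 y = 0 := congrFun (congrArg Subtype.val h) y
      exact (mul_eq_zero.mp h2).resolve_left hy
    refine hg (Subtype.ext (funext fun y => ?_))
    exact AnalyticOnNhd.eqOn_zero_of_preconnected_of_eventuallyEq_zero g.2 isPreconnected_univ
      (Set.mem_univ x) hg0 (Set.mem_univ y)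
  exact NoZeroDivisors.to_isDomain _

/-- The field `K` of meromorphic functions on `ℂ^{n+1}`. Every meromorphic function on `ℂ^{n+1}`
is a quotient of two entire functions, so this is the fraction field of the ring of entire
functions. -/
abbrev Mero (n : ℕ) : Type := FractionRing (Entire n)

/-- The linear form on `ℂ^{n+1}` attached to a lattice vector: `e_a` gives the coordinate `ε_a`.
Lattice vectors in the argument of a theta function stand for these linear forms. -/
def linForm {n : ℕ} (Λ : Lat n) (ε : Fin (n + 1) → ℂ) : ℂ := ∑ a, (Λ a : ℂ) * ε a

theorem analytic_linForm {n : ℕ} (Λ : Lat n) (ε : Fin (n + 1) → ℂ) :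
    AnalyticAt ℂ (fun ε : Fin (n + 1) → ℂ => linForm Λ ε) ε := by
  unfold linForm
  refine Finset.analyticAt_fun_sum _ fun a _ => ?_
  exact analyticAt_const.mul
    ((ContinuousLinearMap.proj (R := ℂ) (φ := fun _ : Fin (n + 1) => ℂ) a).analyticAt ε)

/-- The substitution `g ↦ s_i(g)` on entire functions: `ε_a` is replaced by the linear form of
`s_i(e_a)`, for `0 ≤ a ≤ n`. -/
def subst (m : ℕ) {n : ℕ} (i : Fin n) (g : Entire n) : Entire n :=
  ⟨fun ε => g.1 fun a => linForm (refl m i (e a)) ε, by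
    have hlin : AnalyticOnNhd ℂ (fun ε : Fin (n + 1) → ℂ => fun a : Fin (n + 1) =>
        linForm (refl m i (e a)) ε) Set.univ := by
      intro ε _
      exact AnalyticAt.pi fun a => analytic_linForm _ ε
    exact AnalyticOnNhd.comp g.2 hlin fun _ _ => Set.mem_univ _⟩

/-! ### The odd theta function -/

/-- The odd theta function
`ϑ₁₁(x) = ∑_{k ∈ ℤ} exp(π i (k + 1/2)² ω + 2 π i (k + 1/2) (x + 1/2))` of modulus `ω`. -/
def theta11 (ω x : ℂ) : ℂ :=
  ∑' k : ℤ, Complex.exp (Real.pi * Complex.I * ((k : ℂ) + 1 / 2) ^ 2 * ω +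
    2 * Real.pi * Complex.I * ((k : ℂ) + 1 / 2) * (x + 1 / 2))

theorem theta11_eq (ω x : ℂ) :
    theta11 ω x = Complex.exp (Real.pi * Complex.I * ω / 4 + Real.pi * Complex.I * (x + 1 / 2)) *
      jacobiTheta₂ (x + 1 / 2 + ω / 2) ω := by
  unfold theta11 jacobiTheta₂ jacobiTheta₂_term
  rw [← tsum_mul_left]
  congr 1
  funext k
  rw [← Complex.exp_add]
  congr 1
  ring

theorem differentiable_theta11 {ω : ℂ} (hω : 0 < ω.im) : Differentiable ℂ (theta11 ω) := by
  have h : theta11 ω = fun x => Complex.exp (Real.pi * Complex.I * ω / 4 +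
      Real.pi * Complex.I * (x + 1 / 2)) * jacobiTheta₂ (x + 1 / 2 + ω / 2) ω :=
    funext (theta11_eq ω)
  rw [h]
  intro x
  refine DifferentiableAt.mul (by fun_prop) ?_
  exact (differentiableAt_jacobiTheta₂_fst (x + 1 / 2 + ω / 2) hω).comp x
    (f := fun x : ℂ => x + 1 / 2 + ω / 2) (by fun_prop)

/-- The entire function `[Λ] = ϑ₁₁(Λ)` of `(ε₀, …, εₙ)`, for a lattice vector `Λ` read as a linear
form. -/
def bracket {n : ℕ} (ω : UpperHalfPlane) (Λ : Lat n) : Entire n :=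
  ⟨fun ε => theta11 ω (linForm Λ ε), by
    have h1 : AnalyticOnNhd ℂ (theta11 ω) Set.univ :=
      (differentiable_theta11 ω.im_pos).differentiableOn.analyticOnNhd isOpen_univ
    have h2 : AnalyticOnNhd ℂ (fun ε : Fin (n + 1) → ℂ => linForm Λ ε) Set.univ := by
      exact fun ε _ => analytic_linForm Λ ε
    exact h1.comp h2 fun _ _ => Set.mem_univ _⟩

/-! ### The field `K(f, τ)` and the birational action -/

/-- The field `K(f₁, …, f_m, τ₁, …, τ_n)` of rational functions over `K`, in which the ring
`K(f)[τ₁^±, …, τ_n^±]` lies. -/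
abbrev RatField (m n : ℕ) : Type := FractionRing (MvPolynomial (Fin m ⊕ Fin n) (Mero n))

/-- Entire functions as elements of `K(f, τ)`. -/
def coeff (m : ℕ) {n : ℕ} (g : Entire n) : RatField m n :=
  algebraMap (MvPolynomial (Fin m ⊕ Fin n) (Mero n)) (RatField m n)
    (MvPolynomial.C (algebraMap (Entire n) (Mero n) g))

/-- The indeterminates `f₁, …, f_m`; `fvar a` is `f_{a+1}`. -/
def fvar {m n : ℕ} (a : Fin m) : RatField m n :=
  algebraMap (MvPolynomial (Fin m ⊕ Fin n) (Mero n)) (RatField m n) (MvPolynomial.X (Sum.inl a))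

/-- The indeterminates `τ₁, …, τ_n`; `tvar a` is `τ_{a+1}`. -/
def tvar {m n : ℕ} (a : Fin n) : RatField m n :=
  algebraMap (MvPolynomial (Fin m ⊕ Fin n) (Mero n)) (RatField m n) (MvPolynomial.X (Sum.inr a))

/-- The theta function `[Λ]` as an element of `K(f, τ)`. -/
def br (m : ℕ) {n : ℕ} (ω : UpperHalfPlane) (Λ : Lat n) : RatField m n := coeff m (bracket ω Λ)

/-- The vectors `e_1, …, e_n`; `pt a` is `e_{a+1}`. -/
abbrev pt {n : ℕ} (a : Fin n) : Lat n := e a.succ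

/-- The coefficient
`c_{i,j} = [ε_i - ε_{m+1}] [α₀ + ε_j - ε_{m+1}] / ([ε_i - ε_j] [α₀])`, for indices
`i, j ∈ {1, …, m}`. -/
def cc {m n : ℕ} (hmn : m < n) (ω : UpperHalfPlane) (i j : Fin m) : RatField m n :=
  let ei : Lat n := pt (i.castLE hmn.le)
  let ej : Lat n := pt (j.castLE hmn.le)
  let em1 : Lat n := pt ⟨m, hmn⟩
  let α₀ : Lat n := root m ⟨0, by omega⟩
  (br m ω (ei - em1) * br m ω (α₀ + ej - em1)) / (br m ω (ei - ej) * br m ω α₀)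

/-- The automorphism `σ` of `K(f, τ)` is given by the formulas for the birational action of the
simple reflection `s_i`: the substitution of the `ε`'s on `K`, and the stated values on the `τ`'s
and on the `f`'s. (An automorphism is determined by these values.) -/
structure IsSimple {m n : ℕ} (hmn : m < n) (ω : UpperHalfPlane) (i : Fin n)
    (σ : RatField m n ≃+* RatField m n) : Prop where
  /-- `s_i` acts on the coefficients through the `ε`'s. -/
  on_coeff : ∀ g : Entire n, σ (coeff m g) = coeff m (subst m i g)
  /-- `s₀(τ_a) = f_a τ_a` for `1 ≤ a ≤ m`. -/
  zero_tau : (i : ℕ) = 0 → ∀ a : Fin m,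
    σ (tvar (a.castLE hmn.le)) = fvar a * tvar (a.castLE hmn.le)
  /-- `s₀(τ_a) = τ_a` for `m + 1 ≤ a ≤ n`. -/
  zero_tau_fix : (i : ℕ) = 0 → ∀ a : Fin n, m ≤ (a : ℕ) → σ (tvar a) = tvar a
  /-- For `1 ≤ i ≤ n - 1`, `s_i` interchanges `τ_i` and `τ_{i+1}`, and fixes the other `τ`'s. -/
  tau : ∀ h : 1 ≤ (i : ℕ), ∀ a : Fin n,
    σ (tvar a) = tvar (Equiv.swap (⟨i - 1, by omega⟩ : Fin n) i a)
  /-- `s₀(f_a) = 1 / f_a`. -/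
  zero_f : (i : ℕ) = 0 → ∀ a : Fin m, σ (fvar a) = 1 / fvar a
  /-- For `1 ≤ i ≤ m - 1`, `s_i` interchanges `f_i` and `f_{i+1}`, and fixes the other `f`'s. -/
  f_lt : 1 ≤ (i : ℕ) → ∀ h : (i : ℕ) < m, ∀ a : Fin m,
    σ (fvar a) = fvar (Equiv.swap (⟨i - 1, by omega⟩ : Fin m) ⟨i, h⟩ a)
  /-- `s_m(f_a) = (τ_m / τ_{m+1}) (c_{a,m} f_a + c_{m,a} f_m)` for `1 ≤ a ≤ m - 1`. -/
  f_mid : (i : ℕ) = m → ∀ a b : Fin m, (a : ℕ) + 1 < m → (b : ℕ) + 1 = m →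
    σ (fvar a) = tvar (b.castLE hmn.le) / tvar ⟨m, hmn⟩ *
      (cc hmn ω a b * fvar a + cc hmn ω b a * fvar b)
  /-- `s_m(f_m) = (τ_m / τ_{m+1}) f_m`. -/
  f_mid_last : (i : ℕ) = m → ∀ b : Fin m, (b : ℕ) + 1 = m →
    σ (fvar b) = tvar (b.castLE hmn.le) / tvar ⟨m, hmn⟩ * fvar b
  /-- For `m < i ≤ n - 1`, `s_i` fixes the `f`'s. -/
  f_gt : m < (i : ℕ) → ∀ a : Fin m, σ (fvar a) = fvar a

/-- A group action of `W_{m,n}` on `K(f, τ)` by field automorphisms in which every simple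
reflection `s_i` acts by the formulas of the birational action. -/
def IsBirationalAction {m n : ℕ} (hmn : m < n) (ω : UpperHalfPlane)
    (ρ : Weyl m n →* (RatField m n ≃+* RatField m n)) : Prop :=
  ∀ i : Fin n, IsSimple hmn ω i (ρ ((cs m n).simple i))

open Classical in
/-- The tau function on the orbit `M`: for `Λ ∈ M` choose `w` with `w.e₁ = Λ` and put
`τ(Λ) = w(τ₁)`. (Off the orbit the value is irrelevant.) -/
def tau {m n : ℕ} (hmn : m < n) (ρ : Weyl m n →* (RatField m n ≃+* RatField m n))
    (Λ : Lat n) : RatField m n :=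
  if h : Λ ∈ orbit m hmn then ρ h.choose (tvar (first hmn)) else 0

end

end EllipticTau

namespace EllipticTau

noncomputable section

/-! ### The three-term identity of the odd theta function -/

/-! Each `s_i` is determined by its values on generators, which gives uniqueness. Conversely each
`s_i` extends to an involution of `K(f, τ)`, so existence amounts to the Coxeter relations.

For `s_1, …, s_{n-1}` the relations are linearized. The products `f_a τ_1 ⋯ τ_m` transform by the
same matrices over `K` as the theta functions `Θ_a(x) = [x - ε_a - α_0] ∏_{b ≠ a} [x - ε_b]`
(`basisTheta`), which are acted on by mere substitution. For `s_m` this is the three-term identity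
`theta11_three_term`, whose coefficients are exactly the `c_{a,b}`. The `Θ_a` are linearly
independent over `K` (put `x = ε_a`), so a product of these automorphisms that is trivial on the
lattice is the identity (`IsCompatible.eq_one`).

A relator `R = (s_0 s_j)^k` is inverted under conjugation by `s_0`. Hence, if `R` fixes `K` and all
`τ_a`, it also fixes `s_0(τ_a) = f_a τ_a`, and so `f_a` (`eq_one_of_conj_eq_inv`). Only the `τ_a`
have to be checked, by a short computation in which `s_0` exchanges `c_{a,b}` and `c_{b,a}`.

For the tau function, a permutation moves `e_1` to `e_n`, which pairs nonpositively with every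
simple root. By positivity of roots its stabilizer is generated by the simple reflections fixing it
(`stabilizer_induction`), namely `s_0, …, s_{n-2}`, and all of these fix `τ_n`.

For `L = e_0 - e_1 - ⋯ - e_{m-2}` one has `L - e_m = s_0 e_{m-1}`, `L - e_{m-1} = s_0 e_m` and `L -
e_{m+1} = s_m s_0 e_{m-1}`. The bilinear relation for the indices `m-1, m, m+1` is then the formula
for `s_m(f_{m-1})` with denominators cleared, and permutations give all other cases. -/

theorem summable_norm_exp_quadratic {ω : ℂ} (hω : 0 < ω.im) (c z : ℂ) :
    Summable fun k : ℤ => ‖Complex.exp (c + Real.pi * Complex.I * (k : ℂ) ^ 2 * ω +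
      2 * Real.pi * Complex.I * k * z)‖ := by
  have h := ((summable_jacobiTheta₂_term_iff z ω).mpr hω).mul_left (Complex.exp c)
  refine (h.congr fun k => ?_).norm
  rw [jacobiTheta₂_term, ← Complex.exp_add]
  congr 1
  ring

/-- The terms with even summation index of the auxiliary theta series. -/
def evenTerm (ω x : ℂ) (r : ℤ) : ℂ :=
  Complex.exp (2 * Real.pi * Complex.I * (r : ℂ) ^ 2 * ω + 4 * Real.pi * Complex.I * r * x)

/-- The terms with odd summation index of the auxiliary theta series. -/
def oddTerm (ω x : ℂ) (r : ℤ) : ℂ :=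
  Complex.exp (Real.pi * Complex.I * (2 * (r : ℂ) + 1) ^ 2 / 2 * ω +
    2 * Real.pi * Complex.I * (2 * r + 1) * x)

/-- The terms of the series of `theta11`. -/
def thetaTerm (ω x : ℂ) (k : ℤ) : ℂ :=
  Complex.exp (Real.pi * Complex.I * ((k : ℂ) + 1 / 2) ^ 2 * ω +
    2 * Real.pi * Complex.I * ((k : ℂ) + 1 / 2) * (x + 1 / 2))

theorem summable_norm_evenTerm {ω : ℂ} (hω : 0 < ω.im) (x : ℂ) :
    Summable fun r => ‖evenTerm ω x r‖ := by
  have h2 : 0 < (2 * ω).im := by simpa using hω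
  refine (summable_norm_exp_quadratic h2 0 (2 * x)).congr fun k => ?_
  rw [evenTerm]
  congr 2
  ring

theorem summable_norm_oddTerm {ω : ℂ} (hω : 0 < ω.im) (x : ℂ) :
    Summable fun r => ‖oddTerm ω x r‖ := by
  have h2 : 0 < (2 * ω).im := by simpa using hω
  refine (summable_norm_exp_quadratic h2
    (Real.pi * Complex.I * ω / 2 + 2 * Real.pi * Complex.I * x) (2 * x + ω)).congr fun k => ?_
  rw [oddTerm]
  congr 2
  ring

theorem summable_norm_thetaTerm {ω : ℂ} (hω : 0 < ω.im) (x : ℂ) :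
    Summable fun k => ‖thetaTerm ω x k‖ := by
  refine (summable_norm_exp_quadratic hω
    (Real.pi * Complex.I * ω / 4 + Real.pi * Complex.I * (x + 1 / 2)) (x + 1 / 2 + ω / 2)).congr
      fun k => ?_
  rw [thetaTerm]
  congr 2
  ring

/-- The pairs of integers, separated by the parity of the sum. -/
def parityEquiv : (ℤ × ℤ) ⊕ (ℤ × ℤ) ≃ ℤ × ℤ where
  toFun := Sum.elim (fun p => (p.1 + p.2, p.1 - p.2 - 1)) (fun p => (p.1 + p.2, p.1 - p.2))
  invFun p := if (p.1 + p.2) % 2 = 0 then Sum.inr ((p.1 + p.2) / 2, (p.1 - p.2) / 2)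
    else Sum.inl ((p.1 + p.2 + 1) / 2, (p.1 - p.2 - 1) / 2)
  left_inv := by
    rintro (⟨r, s⟩ | ⟨r, s⟩)
    · have h : ¬ (r + s + (r - s - 1)) % 2 = 0 := by omega
      simp only [Sum.elim_inl, h, if_false, Sum.inl.injEq, Prod.mk.injEq]
      omega
    · have h : (r + s + (r - s)) % 2 = 0 := by omega
      simp only [Sum.elim_inr, h, if_true, Sum.inr.injEq, Prod.mk.injEq]
      omega
  right_inv := by
    rintro ⟨k, l⟩
    by_cases h : (k + l) % 2 = 0
    · simp only [h, if_true, Sum.elim_inr, Prod.mk.injEq]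
      omega
    · simp only [h, if_false, Sum.elim_inl, Prod.mk.injEq]
      omega

theorem thetaTerm_mul_inl (ω x y : ℂ) (r s : ℤ) :
    thetaTerm ω (x + y) (r + s) * thetaTerm ω (x - y) (r - s - 1) =
      evenTerm ω x r * oddTerm ω y s := by
  rw [thetaTerm, thetaTerm, evenTerm, oddTerm, ← Complex.exp_add, ← Complex.exp_add,
    Complex.exp_eq_exp_iff_exists_int]
  -- The shifts of the two arguments by 1/2 contribute `πi (2r)` to the exponent.
  refine ⟨r, ?_⟩
  push_cast
  ring

theorem thetaTerm_mul_inr (ω x y : ℂ) (r s : ℤ) :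
    thetaTerm ω (x + y) (r + s) * thetaTerm ω (x - y) (r - s) =
      -(oddTerm ω x r * evenTerm ω y s) := by
  rw [thetaTerm, thetaTerm, evenTerm, oddTerm, ← Complex.exp_add, ← Complex.exp_add,
    ← neg_one_mul, ← Complex.exp_pi_mul_I, ← Complex.exp_add, Complex.exp_eq_exp_iff_exists_int]
  -- Here the shifts contribute `πi (2r + 1)`; the extra `πi` is the minus sign.
  refine ⟨r, ?_⟩
  push_cast
  ring

/-- Splitting the double series over `(k, l)` by the parity of `k + l` diagonalizes the quadratic
form `(k + 1/2)² + (l + 1/2)²` and separates the sums. The product thus becomes a 2×2 determinant in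
the values at `x` and `y` of two theta series of modulus `2ω`. -/
theorem theta11_add_mul_theta11_sub {ω : ℂ} (hω : 0 < ω.im) (x y : ℂ) :
    theta11 ω (x + y) * theta11 ω (x - y) =
      (∑' r, evenTerm ω x r) * (∑' r, oddTerm ω y r) -
        (∑' r, oddTerm ω x r) * (∑' r, evenTerm ω y r) := by
  have hs := summable_mul_of_summable_norm (summable_norm_thetaTerm hω (x + y))
    (summable_norm_thetaTerm hω (x - y))
  have hs' := (parityEquiv.summable_iff).mpr hs
  have e1 := tsum_mul_tsum_of_summable_norm (summable_norm_thetaTerm hω (x + y))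
    (summable_norm_thetaTerm hω (x - y))
  rw [tsum_mul_tsum_of_summable_norm (summable_norm_evenTerm hω x) (summable_norm_oddTerm hω y),
    tsum_mul_tsum_of_summable_norm (summable_norm_oddTerm hω x) (summable_norm_evenTerm hω y),
    sub_eq_add_neg (tsum _), ← tsum_neg]
  refine e1.trans ?_
  rw [← parityEquiv.tsum_eq]
  refine (Summable.tsum_sum (hs'.comp_injective Sum.inl_injective)
    (hs'.comp_injective Sum.inr_injective)).trans ?_
  congr 1
  · exact tsum_congr fun p => thetaTerm_mul_inl ω x y p.1 p.2
  · exact tsum_congr fun p => thetaTerm_mul_inr ω x y p.1 p.2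

theorem theta11_neg (ω x : ℂ) : theta11 ω (-x) = -theta11 ω x := by
  have h : theta11 ω (-x) = ∑' k, thetaTerm ω (-x) k := rfl
  -- The reindexing `k ↦ -(k + 1)` changes `k + 1/2` into its negative.
  rw [h, ← ((Equiv.addRight (1 : ℤ)).trans (Equiv.neg ℤ)).tsum_eq]
  have h' : theta11 ω x = ∑' k, thetaTerm ω x k := rfl
  rw [h', ← tsum_neg]
  refine tsum_congr fun k => ?_
  rw [thetaTerm, thetaTerm, ← neg_one_mul (Complex.exp _), ← Complex.exp_pi_mul_I, ← Complex.exp_add,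
    Complex.exp_eq_exp_iff_exists_int]
  refine ⟨-k - 1, ?_⟩
  simp only [Equiv.trans_apply, Equiv.coe_addRight, Equiv.neg_apply]
  push_cast
  ring

theorem theta11_zero (ω : ℂ) : theta11 ω 0 = 0 := by
  have h := theta11_neg ω 0
  rw [neg_zero] at h
  exact self_eq_neg.mp h

/-- By `theta11_add_mul_theta11_sub` every product of two theta values is a 2×2 minor of a 2×4
matrix, so the identity is the Plücker relation. The four columns belong to points whose pairwise
sums and differences are, up to sign, the twelve arguments in the statement. -/
theorem theta11_three_term {ω : ℂ} (hω : 0 < ω.im) (x u v w A : ℂ) :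
    theta11 ω (u - v) * theta11 ω A * (theta11 ω (x - u - (A + v - w)) * theta11 ω (x - w)) =
      theta11 ω (u - w) * theta11 ω (A + v - w) * (theta11 ω (x - u - A) * theta11 ω (x - v)) -
      theta11 ω (v - w) * theta11 ω (A + u - w) * (theta11 ω (x - v - A) * theta11 ω (x - u)) := by
  have key := theta11_add_mul_theta11_sub hω
  have t1 := key ((x - u - v + w) / 2) ((x - u - v + w) / 2 - A)
  have t2 := key ((x - w + u - v) / 2) ((x - w - u + v) / 2)
  have t3 := key ((x - u - v + w) / 2) ((x - w + u - v) / 2)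
  have t4 := key ((x - u - v + w) / 2 - A) ((x - w - u + v) / 2)
  have t5 := key ((x - u - v + w) / 2) ((x - w - u + v) / 2)
  have t6 := key ((x - u - v + w) / 2 - A) ((x - w + u - v) / 2)
  generalize ∑' r, evenTerm ω ((x - u - v + w) / 2) r = a₁ at *
  generalize ∑' r, evenTerm ω ((x - u - v + w) / 2 - A) r = a₂ at *
  generalize ∑' r, evenTerm ω ((x - w + u - v) / 2) r = a₃ at *
  generalize ∑' r, evenTerm ω ((x - w - u + v) / 2) r = a₄ at *
  generalize ∑' r, oddTerm ω ((x - u - v + w) / 2) r = b₁ at *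
  generalize ∑' r, oddTerm ω ((x - u - v + w) / 2 - A) r = b₂ at *
  generalize ∑' r, oddTerm ω ((x - w + u - v) / 2) r = b₃ at *
  generalize ∑' r, oddTerm ω ((x - w - u + v) / 2) r = b₄ at *
  rw [show (x - u - v + w) / 2 + ((x - u - v + w) / 2 - A) = x - u - (A + v - w) by ring,
    show (x - u - v + w) / 2 - ((x - u - v + w) / 2 - A) = A by ring] at t1
  rw [show (x - w + u - v) / 2 + (x - w - u + v) / 2 = x - w by ring,
    show (x - w + u - v) / 2 - (x - w - u + v) / 2 = u - v by ring] at t2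
  rw [show (x - u - v + w) / 2 + (x - w + u - v) / 2 = x - v by ring,
    show (x - u - v + w) / 2 - (x - w + u - v) / 2 = -(u - w) by ring, theta11_neg] at t3
  rw [show (x - u - v + w) / 2 - A + (x - w - u + v) / 2 = x - u - A by ring,
    show (x - u - v + w) / 2 - A - (x - w - u + v) / 2 = -(A + v - w) by ring, theta11_neg] at t4
  rw [show (x - u - v + w) / 2 + (x - w - u + v) / 2 = x - u by ring,
    show (x - u - v + w) / 2 - (x - w - u + v) / 2 = -(v - w) by ring, theta11_neg] at t5
  rw [show (x - u - v + w) / 2 - A + (x - w + u - v) / 2 = x - v - A by ring,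
    show (x - u - v + w) / 2 - A - (x - w + u - v) / 2 = -(A + u - w) by ring, theta11_neg] at t6
  linear_combination (theta11 ω (x - w) * theta11 ω (u - v)) * t1 + (a₁ * b₂ - b₁ * a₂) * t2 +
    (theta11 ω (x - u - A) * theta11 ω (A + v - w)) * t3 - (a₁ * b₃ - b₁ * a₃) * t4 -
    (theta11 ω (x - v - A) * theta11 ω (A + u - w)) * t5 + (a₁ * b₄ - b₁ * a₄) * t6

/-- Up to an exponential factor and a shift, `theta11` is a Fourier series whose constant
coefficient is 1, so integration over a period shows that it cannot vanish identically. -/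
theorem exists_theta11_ne_zero {ω : ℂ} (hω : 0 < ω.im) : ∃ x, theta11 ω x ≠ 0 := by
  by_contra! h
  have hz : ∀ z, jacobiTheta₂ z ω = 0 := by
    intro z
    have h1 := h (z - 1 / 2 - ω / 2)
    rw [theta11_eq] at h1
    have h2 := (mul_eq_zero.mp h1).resolve_left (Complex.exp_ne_zero _)
    rwa [show z - 1 / 2 - ω / 2 + 1 / 2 + ω / 2 = z by ring] at h2
  have hc : ∀ k : ℤ, Continuous fun t : ℝ => jacobiTheta₂_term k t ω := by
    intro k
    unfold jacobiTheta₂_term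
    fun_prop
  have hb := (summable_pow_mul_jacobiTheta₂_term_bound 0 hω 0)
  have hs := intervalIntegral.hasSum_intervalIntegral_of_summable_norm (a := 0) (b := 1)
    (f := fun k : ℤ => (⟨fun t : ℝ => jacobiTheta₂_term k t ω, hc k⟩ : C(ℝ, ℂ))) ?_
  · simp only [ContinuousMap.coe_mk] at hs
    have h0 : ∀ t : ℝ, ∑' k : ℤ, jacobiTheta₂_term k t ω = 0 := fun t => hz t
    simp only [h0, intervalIntegral.integral_zero] at hs
    have hk : ∀ k : ℤ, k ≠ 0 → ∫ t in (0 : ℝ)..1, jacobiTheta₂_term k t ω = 0 := by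
      intro k hk
      have hne : 2 * Real.pi * Complex.I * (k : ℂ) ≠ 0 := by
        simp [hk, Real.pi_ne_zero]
      have he : ∀ t : ℝ, jacobiTheta₂_term k t ω =
          Complex.exp (Real.pi * Complex.I * k ^ 2 * ω) *
            Complex.exp (2 * Real.pi * Complex.I * k * t) := by
        intro t
        rw [jacobiTheta₂_term, ← Complex.exp_add, add_comm]
      simp only [he]
      rw [intervalIntegral.integral_const_mul, integral_exp_mul_complex hne]
      have : Complex.exp (2 * Real.pi * Complex.I * k * (1 : ℝ)) = 1 := by
        rw [Complex.exp_eq_one_iff]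
        exact ⟨k, by push_cast; ring⟩
      rw [this]
      simp
    have h1 := hs.unique (hasSum_single 0 hk)
    simp [jacobiTheta₂_term] at h1
  · refine Summable.of_nonneg_of_le (fun _ => norm_nonneg _) (fun k => ?_) hb
    refine (ContinuousMap.norm_le _ ?_).mpr fun t => ?_
    · positivity
    · simpa using norm_jacobiTheta₂_term_le hω (S := 0) (by simp) le_rfl k

end

end EllipticTau
namespace EllipticTau

noncomputable section

/-! ### Semilinear involutions of a field of rational functions -/

/-- The hypothesis `h` says that `φ` writes each `X s` as a fraction `p / q` which `φ` formally
returns to `X s`. It avoids division, since `φ` does not yet act on fractions. The property passes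
to sums and products, hence to all polynomials; there it forces `φ` to be injective, so `φ` extends
to the fraction field, and the extension is an involution. -/
theorem exists_ringEquiv_of_involutive {K σ : Type*} [Field K] (θ : K →+* K)
    (hθ : ∀ c, θ (θ c) = c) (v : σ → FractionRing (MvPolynomial σ K))
    (φ : MvPolynomial σ K →+* FractionRing (MvPolynomial σ K))
    (hC : ∀ c, φ (MvPolynomial.C c) = algebraMap _ _ (MvPolynomial.C (θ c) : MvPolynomial σ K))
    (hX : ∀ s, φ (MvPolynomial.X s) = v s)
    (h : ∀ s, ∃ p q : MvPolynomial σ K, φ q ≠ 0 ∧ v s * algebraMap _ _ q = algebraMap _ _ p ∧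
      algebraMap _ _ (MvPolynomial.X s : MvPolynomial σ K) * φ q = φ p) :
    ∃ Φ : FractionRing (MvPolynomial σ K) ≃+* FractionRing (MvPolynomial σ K),
      (∀ c, Φ (algebraMap _ _ (MvPolynomial.C c : MvPolynomial σ K)) = algebraMap _ _ (MvPolynomial.C (θ c) : MvPolynomial σ K)) ∧
      (∀ s, Φ (algebraMap _ _ (MvPolynomial.X s : MvPolynomial σ K)) = v s) ∧ ∀ x, Φ (Φ x) = x := by
  have key : ∀ x : MvPolynomial σ K, ∃ p q : MvPolynomial σ K, φ q ≠ 0 ∧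
      φ x * algebraMap _ _ q = algebraMap _ _ p ∧ algebraMap _ _ x * φ q = φ p := by
    intro x
    induction x using MvPolynomial.induction_on with
    | C c => exact ⟨MvPolynomial.C (θ c), 1, by simp, by rw [hC]; simp, by rw [hC, hθ]; simp⟩
    | add x y hx hy =>
      obtain ⟨p, q, h1, h2, h3⟩ := hx
      obtain ⟨p', q', h1', h2', h3'⟩ := hy
      refine ⟨p * q' + p' * q, q * q', by rw [map_mul]; exact mul_ne_zero h1 h1', ?_, ?_⟩
      · simp only [map_add, map_mul, ← h2, ← h2']
        ring
      · simp only [map_add, map_mul, ← h3, ← h3']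
        ring
    | mul_X x s hx =>
      obtain ⟨p, q, h1, h2, h3⟩ := hx
      obtain ⟨p', q', h1', h2', h3'⟩ := h s
      refine ⟨p * p', q * q', by rw [map_mul]; exact mul_ne_zero h1 h1', ?_, ?_⟩
      · simp only [map_mul, hX, ← h2, ← h2']
        ring
      · simp only [map_mul, ← h3, ← h3']
        ring
  have hinj : Function.Injective φ := by
    rw [injective_iff_map_eq_zero]
    intro x hx
    obtain ⟨p, q, h1, h2, h3⟩ := key x
    -- If `φ x = 0` then `p = 0`, so `x * φ q = 0` with `φ q ≠ 0`.
    rw [hx, zero_mul, eq_comm, map_eq_zero_iff _ (IsFractionRing.injective _ _)] at h2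
    rw [h2, map_zero] at h3
    exact (map_eq_zero_iff _ (IsFractionRing.injective _ _)).mp
      ((mul_eq_zero.mp h3).resolve_right h1)
  have hlift : ∀ x, IsFractionRing.lift hinj
      (algebraMap _ (FractionRing (MvPolynomial σ K)) x) = φ x :=
    IsFractionRing.lift_algebraMap hinj
  have hinv : ∀ x, IsFractionRing.lift hinj (IsFractionRing.lift hinj x) = x := by
    intro x
    have h0 : ∀ x : MvPolynomial σ K,
        IsFractionRing.lift hinj (φ x) = algebraMap _ (FractionRing (MvPolynomial σ K)) x := by
      intro x
      obtain ⟨p, q, h1, h2, h3⟩ := key x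
      have h4 := congrArg (IsFractionRing.lift hinj) h2
      rw [map_mul, hlift, hlift, ← h3] at h4
      exact mul_right_cancel₀ h1 h4
    obtain ⟨a, b, -, rfl⟩ := IsFractionRing.div_surjective (A := MvPolynomial σ K) x
    rw [map_div₀, map_div₀, hlift, hlift, h0, h0]
  exact ⟨RingEquiv.ofRingHom (IsFractionRing.lift hinj) (IsFractionRing.lift hinj)
    (RingHom.ext hinv) (RingHom.ext hinv), fun c => (hlift _).trans (hC c),
    fun s => (hlift _).trans (hX s), hinv⟩

/-! ### Pullback of entire functions along lattice endomorphisms -/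

theorem linForm_add {n : ℕ} (x y : Lat n) (ε : Fin (n + 1) → ℂ) :
    linForm (x + y) ε = linForm x ε + linForm y ε := by
  simp [linForm, add_mul, Finset.sum_add_distrib]

/-- The linear form of a lattice vector, as an additive map. -/
def linFormHom {n : ℕ} (ε : Fin (n + 1) → ℂ) : Lat n →+ ℂ :=
  AddMonoidHom.mk' (fun x => linForm x ε) fun x y => linForm_add x y ε

theorem linForm_sub {n : ℕ} (x y : Lat n) (ε : Fin (n + 1) → ℂ) :
    linForm (x - y) ε = linForm x ε - linForm y ε := map_sub (linFormHom ε) x y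

theorem linForm_neg {n : ℕ} (x : Lat n) (ε : Fin (n + 1) → ℂ) :
    linForm (-x) ε = -linForm x ε := map_neg (linFormHom ε) x

theorem linForm_e {n : ℕ} (a : Fin (n + 1)) (ε : Fin (n + 1) → ℂ) : linForm (e a) ε = ε a := by
  simp [linForm, e, Pi.single_apply]

theorem sum_smul_e {n : ℕ} (Λ : Lat n) : ∑ a, Λ a • e a = Λ := by
  funext b
  simp [e, Pi.single_apply]

theorem linForm_comp {n : ℕ} (T : Module.End ℤ (Lat n)) (Λ : Lat n) (ε : Fin (n + 1) → ℂ) :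
    linForm Λ (fun a => linForm (T (e a)) ε) = linForm (T Λ) ε := by
  conv_rhs => rw [← sum_smul_e Λ, map_sum]
  have h := map_sum (linFormHom ε) (fun a => T (Λ a • e a)) Finset.univ
  refine Eq.trans ?_ h.symm
  unfold linForm
  refine Finset.sum_congr rfl fun a _ => ?_
  rw [map_zsmul, map_zsmul, zsmul_eq_mul]
  rfl

/-- The substitution `ε_a ↦` (linear form of `T e_a`) on entire functions. -/
def pullback {n : ℕ} (T : Module.End ℤ (Lat n)) : Entire n →+* Entire n where
  toFun g := ⟨fun ε => g.1 fun a => linForm (T (e a)) ε, by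
    have hlin : AnalyticOnNhd ℂ (fun ε : Fin (n + 1) → ℂ => fun a : Fin (n + 1) =>
        linForm (T (e a)) ε) Set.univ := by
      intro ε _
      exact AnalyticAt.pi fun a => analytic_linForm _ ε
    exact AnalyticOnNhd.comp g.2 hlin fun _ _ => Set.mem_univ _⟩
  map_one' := rfl
  map_mul' _ _ := rfl
  map_zero' := rfl
  map_add' _ _ := rfl

theorem subst_eq_pullback (m : ℕ) {n : ℕ} (i : Fin n) (g : Entire n) :
    subst m i g = pullback (refl m i) g := rfl

/-- The order of composition is preserved: substituting the forms of `T e_a` turns the linear form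
of `Λ` into that of `T Λ`, so lattice endomorphisms act on functions from the left. -/
theorem pullback_mul {n : ℕ} (T T' : Module.End ℤ (Lat n)) (g : Entire n) :
    pullback (T * T') g = pullback T (pullback T' g) := by
  refine Subtype.ext (funext fun ε => ?_)
  change g.1 _ = g.1 _
  exact congrArg g.1 (funext fun a => (linForm_comp T _ ε).symm)

theorem pullback_one {n : ℕ} (g : Entire n) : pullback 1 g = g := by
  refine Subtype.ext (funext fun ε => ?_)
  change g.1 _ = g.1 _
  exact congrArg g.1 (funext fun a => linForm_e a ε)

/-- The entire function `[x - Λ]` of `ε`, for a constant `x`. -/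
def shiftedBracket {n : ℕ} (ω : UpperHalfPlane) (x : ℂ) (Λ : Lat n) : Entire n :=
  ⟨fun ε => theta11 ω (x - linForm Λ ε), by
    have h1 : AnalyticOnNhd ℂ (theta11 ω) Set.univ :=
      (differentiable_theta11 ω.im_pos).differentiableOn.analyticOnNhd isOpen_univ
    have h2 : AnalyticOnNhd ℂ (fun ε : Fin (n + 1) → ℂ => x - linForm Λ ε) Set.univ := by
      exact fun ε _ => analyticAt_const.sub (analytic_linForm Λ ε)
    exact h1.comp h2 fun _ _ => Set.mem_univ _⟩

theorem pullback_bracket {n : ℕ} (T : Module.End ℤ (Lat n)) (ω : UpperHalfPlane) (Λ : Lat n) :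
    pullback T (bracket ω Λ) = bracket ω (T Λ) :=
  Subtype.ext (funext fun ε => congrArg (theta11 ω) (linForm_comp T Λ ε))

theorem pullback_shiftedBracket {n : ℕ} (T : Module.End ℤ (Lat n)) (ω : UpperHalfPlane) (x : ℂ)
    (Λ : Lat n) : pullback T (shiftedBracket ω x Λ) = shiftedBracket ω x (T Λ) :=
  Subtype.ext (funext fun ε => congrArg (fun y => theta11 ω (x - y)) (linForm_comp T Λ ε))

theorem bracket_neg {n : ℕ} (ω : UpperHalfPlane) (Λ : Lat n) :
    bracket ω (-Λ) = -bracket ω Λ := by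
  refine Subtype.ext (funext fun ε => ?_)
  change theta11 ω (linForm (-Λ) ε) = -theta11 ω (linForm Λ ε)
  rw [linForm_neg, theta11_neg]

theorem bracket_ne_zero {n : ℕ} (ω : UpperHalfPlane) {Λ : Lat n} (hΛ : Λ ≠ 0) :
    bracket ω Λ ≠ 0 := by
  intro h
  obtain ⟨a, ha⟩ := Function.ne_iff.mp hΛ
  obtain ⟨x, hx⟩ := exists_theta11_ne_zero ω.im_pos
  have ha' : (Λ a : ℂ) ≠ 0 := by exact_mod_cast ha
  -- On the coordinate axis `a` the linear form takes every complex value, in particular `x`.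
  have h2 := congrFun (congrArg Subtype.val h) (Pi.single a (x / Λ a))
  change theta11 ω (linForm Λ (Pi.single a (x / Λ a))) = 0 at h2
  have h3 : linForm Λ (Pi.single a (x / Λ a)) = x := by
    simp [linForm, Pi.single_apply]
    field_simp
  exact hx (h3 ▸ h2)

/-! ### Coefficients in the field `K(f, τ)` -/

theorem ratField_nontrivial {m n : ℕ} : Nontrivial (RatField m n) := inferInstance

/-- The field structure of `K(f, τ)`, for faster instance resolution. -/
abbrev ratFieldField {m n : ℕ} : Field (RatField m n) := inferInstance

attribute [local instance] ratField_nontrivial ratFieldField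

theorem ratField_neZero_one {m n : ℕ} : NeZero (1 : RatField m n) := ⟨one_ne_zero⟩

attribute [local instance] ratField_neZero_one

/-- The inclusion of the field of meromorphic functions into `K(f, τ)`. -/
def meroCoeff (m n : ℕ) : Mero n →+* RatField m n :=
  (algebraMap (MvPolynomial (Fin m ⊕ Fin n) (Mero n)) (RatField m n)).comp MvPolynomial.C

/-- The inclusion of the ring of entire functions into `K(f, τ)`. -/
def coeffHom (m n : ℕ) : Entire n →+* RatField m n :=
  (meroCoeff m n).comp (algebraMap (Entire n) (Mero n))

theorem coeff_eq (m : ℕ) {n : ℕ} (g : Entire n) : coeff m g = coeffHom m n g := rfl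

theorem coeffHom_injective (m n : ℕ) : Function.Injective (coeffHom m n) :=
  (meroCoeff m n).injective.comp (IsFractionRing.injective _ _)

theorem br_neg (m : ℕ) {n : ℕ} (ω : UpperHalfPlane) (Λ : Lat n) : br m ω (-Λ) = -br m ω Λ := by
  rw [br, br, bracket_neg, coeff_eq, map_neg, coeff_eq]

theorem br_ne_zero (m : ℕ) {n : ℕ} (ω : UpperHalfPlane) {Λ : Lat n} (hΛ : Λ ≠ 0) :
    br m ω Λ ≠ 0 := by
  rw [br, coeff_eq, Ne, map_eq_zero_iff _ (coeffHom_injective m n)]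
  exact bracket_ne_zero ω hΛ

theorem tvar_ne_zero {m n : ℕ} (a : Fin n) : (tvar a : RatField m n) ≠ 0 := by
  rw [tvar, Ne, map_eq_zero_iff _ (IsFractionRing.injective _ _)]
  exact MvPolynomial.X_ne_zero _

theorem fvar_ne_zero {m n : ℕ} (a : Fin m) : (fvar a : RatField m n) ≠ 0 := by
  rw [fvar, Ne, map_eq_zero_iff _ (IsFractionRing.injective _ _)]
  exact MvPolynomial.X_ne_zero _

theorem ringHom_ext {m n : ℕ} {S : Type*} [Field S] {φ ψ : RatField m n →+* S}
    (hc : ∀ g, φ (coeff m g) = ψ (coeff m g)) (hf : ∀ a, φ (fvar a) = ψ (fvar a))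
    (ht : ∀ a, φ (tvar a) = ψ (tvar a)) : φ = ψ := by
  refine IsLocalization.ringHom_ext
    (nonZeroDivisors (MvPolynomial (Fin m ⊕ Fin n) (Mero n))) ?_
  refine MvPolynomial.ringHom_ext' ?_ ?_
  · refine IsLocalization.ringHom_ext (nonZeroDivisors (Entire n)) (RingHom.ext hc)
  · rintro (a | a)
    · exact hf a
    · exact ht a

theorem ringEquiv_ext {m n : ℕ} {σ σ' : RatField m n ≃+* RatField m n}
    (hc : ∀ g, σ (coeff m g) = σ' (coeff m g)) (hf : ∀ a, σ (fvar a) = σ' (fvar a))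
    (ht : ∀ a, σ (tvar a) = σ' (tvar a)) : σ = σ' := by
  have h : (σ : RatField m n →+* RatField m n) = σ' := ringHom_ext hc hf ht
  exact RingEquiv.ext fun x => congrArg (fun φ : RatField m n →+* RatField m n => φ x) h

theorem isSimple_unique {m n : ℕ} (hmn : m < n) (ω : UpperHalfPlane) (i : Fin n)
    {σ σ' : RatField m n ≃+* RatField m n} (h : IsSimple hmn ω i σ) (h' : IsSimple hmn ω i σ') :
    σ = σ' := by
  refine ringEquiv_ext (fun g => by rw [h.on_coeff, h'.on_coeff]) (fun a => ?_) fun a => ?_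
  · rcases Nat.eq_zero_or_pos i with hi | hi
    · rw [h.zero_f hi, h'.zero_f hi]
    rcases lt_trichotomy (i : ℕ) m with him | him | him
    · rw [h.f_lt hi him, h'.f_lt hi him]
    · by_cases ha : (a : ℕ) + 1 < m
      · have hb : ((⟨m - 1, by omega⟩ : Fin m) : ℕ) + 1 = m := by simp; omega
        rw [h.f_mid him a _ ha hb, h'.f_mid him a _ ha hb]
      · have hb : (a : ℕ) + 1 = m := by omega
        rw [h.f_mid_last him a hb, h'.f_mid_last him a hb]
    · rw [h.f_gt him, h'.f_gt him]
  · rcases Nat.eq_zero_or_pos i with hi | hi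
    · by_cases ha : (a : ℕ) < m
      · have h1 := h.zero_tau hi ⟨a, ha⟩
        have h2 := h'.zero_tau hi ⟨a, ha⟩
        exact h1.trans h2.symm
      · rw [h.zero_tau_fix hi a (by omega), h'.zero_tau_fix hi a (by omega)]
    · rw [h.tau hi, h'.tau hi]

end

end EllipticTau
namespace EllipticTau

noncomputable section

attribute [local instance] ratField_nontrivial ratFieldField ratField_neZero_one

/-! ### Reflections of the basis vectors and of the simple roots -/

theorem refl_apply (m : ℕ) {n : ℕ} (i : Fin n) (x : Lat n) :
    refl m i x = x - metric m (root m i) x • root m i := rfl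

theorem refl_mul_self (m : ℕ) {n : ℕ} (hmn : m < n) (i : Fin n) :
    refl m i * refl m i = (1 : Module.End ℤ (Lat n)) := by
  have h := refl_liftable m hmn i i
  rwa [(cox m n).diagonal, pow_one] at h

theorem refl_root_self (m : ℕ) {n : ℕ} (hmn : m < n) (i : Fin n) :
    refl m i (root m i) = -root m i := by
  rw [refl_apply, metric_root m hmn, if_pos rfl, two_smul]
  abel

theorem refl_zero_pt (m : ℕ) {n : ℕ} (i a : Fin n) (hi : (i : ℕ) = 0) :
    refl m i (pt a) = if (a : ℕ) < m then pt a + root m i else pt a := by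
  rw [refl_apply, metric_e_succ, root_zero_apply_succ m i a hi]
  split_ifs
  · rw [neg_smul, one_smul, sub_neg_eq_add]
  · rw [zero_smul, sub_zero]

theorem root_pos_eq (m : ℕ) {n : ℕ} (i : Fin n) (hi : 1 ≤ (i : ℕ)) :
    (root m i : Lat n) = pt ⟨i - 1, by omega⟩ - pt i := by
  have h : i.castSucc = (⟨i - 1, by omega⟩ : Fin n).succ := by
    ext; simp; omega
  rw [root, if_neg (by omega), h]

theorem pt_apply_zero {n : ℕ} (a : Fin n) : (pt a : Lat n) 0 = 0 := by
  simp [e]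

theorem pt_apply_succ {n : ℕ} (a b : Fin n) : (pt a : Lat n) b.succ = if b = a then 1 else 0 := by
  simp [e, Pi.single_apply]

theorem pt_injective {n : ℕ} : Function.Injective (pt : Fin n → Lat n) := by
  intro a b h
  by_contra hab
  have h1 := congrFun h a.succ
  rw [pt_apply_succ, pt_apply_succ, if_pos rfl, if_neg hab] at h1
  exact one_ne_zero h1

theorem refl_pos_pt (m : ℕ) {n : ℕ} (i a : Fin n) (hi : 1 ≤ (i : ℕ)) :
    refl m i (pt a) = pt (Equiv.swap (⟨i - 1, by omega⟩ : Fin n) i a) := by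
  have hne : (⟨i - 1, by omega⟩ : Fin n) ≠ i := by
    intro h
    have := congrArg Fin.val h
    simp only at this
    omega
  rw [refl_apply, metric_e_succ, root_pos_eq m i hi, Pi.sub_apply, pt_apply_succ, pt_apply_succ]
  by_cases h1 : a = ⟨i - 1, by omega⟩
  · rw [if_pos h1, if_neg (h1 ▸ hne), h1, Equiv.swap_apply_left]
    module
  by_cases h2 : a = i
  · rw [if_neg h1, if_pos h2, h2, Equiv.swap_apply_right]
    module
  · rw [if_neg h1, if_neg h2, Equiv.swap_apply_of_ne_of_ne h1 h2]
    module

theorem refl_pos_e_zero (m : ℕ) {n : ℕ} (i : Fin n) (hi : 1 ≤ (i : ℕ)) :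
    refl m i (e 0) = e 0 := by
  rw [refl_apply, metric_e_zero, root_pos_eq m i hi, Pi.sub_apply, pt_apply_zero, pt_apply_zero]
  simp

theorem refl_pos_root_zero (m : ℕ) {n : ℕ} (hmn : m < n) (i z : Fin n) (hi : 1 ≤ (i : ℕ))
    (hz : (z : ℕ) = 0) :
    refl m i (root m z) = if (i : ℕ) = m then root m z + root m i else root m z := by
  have hne : i ≠ z := by rintro rfl; omega
  have hA : Adjacent m i z ↔ (i : ℕ) = m := by unfold Adjacent; omega
  rw [refl_apply, metric_root m hmn, if_neg hne, if_congr hA rfl rfl]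
  split_ifs
  · rw [neg_smul, one_smul, sub_neg_eq_add]
  · rw [zero_smul, sub_zero]

theorem pt_sub_pt_ne_zero {n : ℕ} {a b : Fin n} (h : a ≠ b) : (pt a - pt b : Lat n) ≠ 0 :=
  fun h' => h (pt_injective (sub_eq_zero.mp h'))

theorem root_zero_ne_zero (m : ℕ) {n : ℕ} (z : Fin n) (hz : (z : ℕ) = 0) :
    (root m z : Lat n) ≠ 0 := by
  intro h
  have := root_zero_apply_zero (n := n) m z hz
  rw [h] at this
  exact zero_ne_one this

theorem root_zero_add_ne_zero (m : ℕ) {n : ℕ} (z a b : Fin n) (hz : (z : ℕ) = 0) :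
    (root m z + pt a - pt b : Lat n) ≠ 0 := by
  intro h
  have h1 := congrFun h 0
  rw [Pi.sub_apply, Pi.add_apply, root_zero_apply_zero m z hz, pt_apply_zero, pt_apply_zero] at h1
  simp at h1

/-! ### The coefficients of the birational action -/

/-- The ratio `[u - w] [A + v - w] / ([u - v] [A])`. -/
def ratio (m : ℕ) {n : ℕ} (ω : UpperHalfPlane) (u v w A : Lat n) : RatField m n :=
  (br m ω (u - w) * br m ω (A + v - w)) / (br m ω (u - v) * br m ω A)

theorem cc_eq_ratio {m n : ℕ} (hmn : m < n) (ω : UpperHalfPlane) (i j : Fin m) :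
    cc hmn ω i j = ratio m ω (pt (i.castLE hmn.le)) (pt (j.castLE hmn.le)) (pt ⟨m, hmn⟩)
      (root m (⟨0, by omega⟩ : Fin n)) := rfl

theorem div_mul_div_cancel_of_ne {F : Type*} [Field F] {p q : F} (hp : p ≠ 0) (hq : q ≠ 0) :
    q / p * (p / q) = 1 := by
  field_simp

theorem div_mul_div_add_div_eq_zero {F : Type*} [Field F] {p q r s : F} (t x : F) (hp : p ≠ 0)
    (hq : q ≠ 0) (hr : r ≠ 0) (hs : s ≠ 0) :
    p * r / (q * s) * (t * x / (-p * r)) + -t * x / (-q * s) = 0 := by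
  field_simp
  ring

/-- The constants `c_{a,b}` are needed as elements of `K`, since the involution criterion and the
matrices in `IsCompatible` have entries there. The preimage comes together with its image under
every substitution. -/
theorem meroCoeff_ratio (m : ℕ) {n : ℕ} (ω : UpperHalfPlane) (u v w A : Lat n) :
    ∃ c : Mero n, meroCoeff m n c = ratio m ω u v w A ∧
      ∀ (θ : Mero n →+* Mero n) (T : Module.End ℤ (Lat n)),
        (∀ g : Entire n, θ (algebraMap _ _ g) = algebraMap _ _ (pullback T g)) →
          meroCoeff m n (θ c) = ratio m ω (T u) (T v) (T w) (T A) := by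
  refine ⟨(algebraMap _ _ (bracket ω (u - w)) * algebraMap _ _ (bracket ω (A + v - w))) /
    (algebraMap _ _ (bracket ω (u - v)) * algebraMap _ _ (bracket ω A)), ?_, ?_⟩
  · simp only [map_div₀, map_mul]
    rfl
  · intro θ T h
    simp only [map_div₀, map_mul, h, pullback_bracket, map_add, map_sub]
    rfl

theorem map_ratio {m n : ℕ} {ω : UpperHalfPlane} {σ : RatField m n ≃+* RatField m n}
    {T : Module.End ℤ (Lat n)} (h : ∀ g, σ (coeff m g) = coeff m (pullback T g))
    (u v w A : Lat n) : σ (ratio m ω u v w A) = ratio m ω (T u) (T v) (T w) (T A) := by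
  simp only [ratio, br, map_div₀, map_mul, h, pullback_bracket, map_add, map_sub]

/-- With `u = ε_a`, `v = ε_m`, `w = ε_{m+1}`, `A = α_0`, the reflection `s_m` exchanges `v` and `w`
and sends `A` to `A + (v - w)`. Together with `ratio_mul_ratio_add`, this says that the triangular
matrix of `s_m` on `f_a, f_m`, with the monomial factor removed, is inverted by applying `s_m` to
its entries; hence `s_m² = 1`. -/
theorem ratio_mul_ratio (m : ℕ) {n : ℕ} (ω : UpperHalfPlane) {u v w A : Lat n} (huv : u - v ≠ 0)
    (huw : u - w ≠ 0) (hA : A ≠ 0) (hA' : A + v - w ≠ 0) :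
    ratio m ω u w v (A + (v - w)) * ratio m ω u v w A = 1 := by
  rw [ratio, ratio, show A + (v - w) + w - v = A by abel, show A + (v - w) = A + v - w by abel]
  exact div_mul_div_cancel_of_ne
    (mul_ne_zero (br_ne_zero m ω huw) (br_ne_zero m ω hA'))
    (mul_ne_zero (br_ne_zero m ω huv) (br_ne_zero m ω hA))

theorem ratio_mul_ratio_add (m : ℕ) {n : ℕ} (ω : UpperHalfPlane) {u v w A : Lat n}
    (huv : u - v ≠ 0) (huw : u - w ≠ 0) (hA : A ≠ 0) (hA' : A + v - w ≠ 0) :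
    ratio m ω u w v (A + (v - w)) * ratio m ω v u w A + ratio m ω w u v (A + (v - w)) = 0 := by
  rw [ratio, ratio, ratio, show A + (v - w) + w - v = A by abel,
    show A + (v - w) + u - v = A + u - w by abel,
    show A + (v - w) = A + v - w by abel, ← neg_sub u v, ← neg_sub u w, ← neg_sub v w,
    br_neg, br_neg, br_neg]
  exact div_mul_div_add_div_eq_zero _ _ (br_ne_zero m ω huv) (br_ne_zero m ω huw)
    (br_ne_zero m ω hA) (br_ne_zero m ω hA')

/-! ### The simple reflections of `K(f, τ)` -/

theorem exists_meroEquiv {n : ℕ} (T : Module.End ℤ (Lat n)) (hT : T * T = 1) :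
    ∃ θ : Mero n →+* Mero n,
      (∀ g : Entire n, θ (algebraMap _ _ g) = algebraMap _ _ (pullback T g)) ∧
      ∀ c, θ (θ c) = c := by
  have hp : ∀ g, pullback T (pullback T g) = g := fun g => by
    rw [← pullback_mul, hT, pullback_one]
  have hinj : Function.Injective ((algebraMap (Entire n) (Mero n)).comp (pullback T)) :=
    (IsFractionRing.injective _ _).comp (Function.LeftInverse.injective hp)
  have h1 : ∀ g : Entire n, IsFractionRing.lift hinj (algebraMap _ (Mero n) g) =
      algebraMap _ _ (pullback T g) := IsFractionRing.lift_algebraMap hinj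
  refine ⟨IsFractionRing.lift hinj, h1, fun c => ?_⟩
  obtain ⟨a, b, -, rfl⟩ := IsFractionRing.div_surjective (A := Entire n) c
  rw [map_div₀, map_div₀, h1, h1, h1, h1, hp, hp]

/-- The values of the simple reflection `s_i` on the indeterminates. -/
def simpleVal {m n : ℕ} (hmn : m < n) (ω : UpperHalfPlane) (i : Fin n) :
    Fin m ⊕ Fin n → RatField m n
  | Sum.inl a =>
    have hm : 0 < m := a.pos
    if (i : ℕ) = 0 then 1 / fvar a
    else if h : (i : ℕ) < m then fvar (Equiv.swap (⟨i - 1, by omega⟩ : Fin m) ⟨i, h⟩ a)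
    else if (i : ℕ) = m then
      if (a : ℕ) + 1 < m then
        tvar ⟨m - 1, by omega⟩ / tvar ⟨m, hmn⟩ *
          (cc hmn ω a ⟨m - 1, by omega⟩ * fvar a +
            cc hmn ω ⟨m - 1, by omega⟩ a * fvar ⟨m - 1, by omega⟩)
      else tvar ⟨m - 1, by omega⟩ / tvar ⟨m, hmn⟩ * fvar a
    else fvar a
  | Sum.inr a =>
    if (i : ℕ) = 0 then if h : (a : ℕ) < m then fvar ⟨a, h⟩ * tvar a else tvar a
    else tvar (Equiv.swap (⟨i - 1, by omega⟩ : Fin n) i a)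

/-- The homomorphism `φ` sends the indeterminate `X s` to a fraction that `φ` sends back to
`X s`. -/
def IsReversed {m n : ℕ} (φ : MvPolynomial (Fin m ⊕ Fin n) (Mero n) →+* RatField m n)
    (s : Fin m ⊕ Fin n) : Prop :=
  ∃ p q : MvPolynomial (Fin m ⊕ Fin n) (Mero n), φ q ≠ 0 ∧
    φ (MvPolynomial.X s) * algebraMap _ (RatField m n) q = algebraMap _ (RatField m n) p ∧
    algebraMap _ (RatField m n) (MvPolynomial.X s : MvPolynomial (Fin m ⊕ Fin n) (Mero n)) * φ q =
      φ p

theorem isReversed_of_polynomial {m n : ℕ}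
    {φ : MvPolynomial (Fin m ⊕ Fin n) (Mero n) →+* RatField m n} {s : Fin m ⊕ Fin n}
    (p : MvPolynomial (Fin m ⊕ Fin n) (Mero n))
    (h1 : φ (MvPolynomial.X s) = algebraMap _ (RatField m n) p)
    (h2 : φ p = algebraMap _ (RatField m n)
      (MvPolynomial.X s : MvPolynomial (Fin m ⊕ Fin n) (Mero n))) : IsReversed φ s :=
  ⟨p, 1, by rw [map_one]; exact one_ne_zero, by rw [map_one, mul_one, h1],
    by rw [map_one, mul_one, h2]⟩

theorem isReversed_of_inv {m n : ℕ}
    {φ : MvPolynomial (Fin m ⊕ Fin n) (Mero n) →+* RatField m n} {a : Fin m}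
    (h : φ (MvPolynomial.X (Sum.inl a)) = 1 / fvar a) : IsReversed φ (Sum.inl a) := by
  have hne := fvar_ne_zero (n := n) a
  refine ⟨1, MvPolynomial.X (Sum.inl a), ?_, ?_, ?_⟩
  · rw [h]
    exact one_div_ne_zero hne
  · rw [h, map_one]
    exact one_div_mul_cancel hne
  · rw [h, map_one]
    exact mul_one_div_cancel hne

theorem mul_inv_mul_cancel_of_ne {F : Type*} [Field F] {f : F} (hf : f ≠ 0) (t : F) :
    1 / f * (f * t) = t := by
  field_simp

theorem isReversed_of_mul {m n : ℕ}
    {φ : MvPolynomial (Fin m ⊕ Fin n) (Mero n) →+* RatField m n} {a : Fin m} {b : Fin n}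
    (h : φ (MvPolynomial.X (Sum.inl a)) = 1 / fvar a)
    (h' : φ (MvPolynomial.X (Sum.inr b)) = fvar a * tvar b) : IsReversed φ (Sum.inr b) := by
  refine isReversed_of_polynomial (MvPolynomial.X (Sum.inl a) * MvPolynomial.X (Sum.inr b)) ?_ ?_
  · rw [h', map_mul]
    rfl
  · rw [map_mul, h, h']
    exact mul_inv_mul_cancel_of_ne (fvar_ne_zero a) _

theorem div_mul_mul_cancel_of_ne {F : Type*} [Field F] {t : F} (ht : t ≠ 0) (t' x : F) :
    t' / t * x * t = t' * x := by
  field_simp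

theorem mul_eq_mul_div_mul {F : Type*} [Field F] {t : F} (ht : t ≠ 0) (t' x : F) :
    x * t' = t * (t' / t * x) := by
  field_simp

theorem eq_of_ratio_relations {F : Type*} [Field F] {t t' : F} (ht : t ≠ 0)
    {f g c₁ c₂ d₁ d₂ : F} (h1 : d₁ * c₁ = 1) (h2 : d₁ * c₂ + d₂ = 0) :
    f * t' = t * (d₁ * (t' / t * (c₁ * f + c₂ * g)) + d₂ * (t' / t * g)) := by
  field_simp
  linear_combination (-f * t') * h1 - g * t' * h2

/-- The fraction is `p / q` with `q = τ_{m+1}` and numerator `τ_m (c₁ f_a + c₂ f_m)`. Applying `φ`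
once more multiplies the triangular matrix by its twist, and `h1`, `h2` say that the product is the
identity. -/
theorem isReversed_of_ratio {m n : ℕ}
    {φ : MvPolynomial (Fin m ⊕ Fin n) (Mero n) →+* RatField m n} {θ : Mero n →+* Mero n}
    (hC : ∀ c, φ (MvPolynomial.C c) = meroCoeff m n (θ c)) {a b : Fin m} {p q : Fin n}
    {c₁ c₂ : Mero n} (h1 : meroCoeff m n (θ c₁) * meroCoeff m n c₁ = 1)
    (h2 : meroCoeff m n (θ c₁) * meroCoeff m n c₂ + meroCoeff m n (θ c₂) = 0)
    (hq : φ (MvPolynomial.X (Sum.inr q)) = tvar p) (hp : φ (MvPolynomial.X (Sum.inr p)) = tvar q)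
    (ha : φ (MvPolynomial.X (Sum.inl a)) =
      tvar p / tvar q * (meroCoeff m n c₁ * fvar a + meroCoeff m n c₂ * fvar b))
    (hb : φ (MvPolynomial.X (Sum.inl b)) = tvar p / tvar q * fvar b) :
    IsReversed φ (Sum.inl a) := by
  refine ⟨MvPolynomial.X (Sum.inr p) *
    (MvPolynomial.C c₁ * MvPolynomial.X (Sum.inl a) +
      MvPolynomial.C c₂ * MvPolynomial.X (Sum.inl b)), MvPolynomial.X (Sum.inr q), ?_, ?_, ?_⟩
  · rw [hq]
    exact tvar_ne_zero p
  · rw [ha, map_mul, map_add, map_mul, map_mul]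
    exact div_mul_mul_cancel_of_ne (tvar_ne_zero q) _ _
  · rw [hq, map_mul, map_add, map_mul, map_mul, hC, hC, hp, ha, hb]
    exact eq_of_ratio_relations (tvar_ne_zero q) h1 h2

theorem isReversed_of_div {m n : ℕ}
    {φ : MvPolynomial (Fin m ⊕ Fin n) (Mero n) →+* RatField m n} {b : Fin m} {p q : Fin n}
    (hq : φ (MvPolynomial.X (Sum.inr q)) = tvar p) (hp : φ (MvPolynomial.X (Sum.inr p)) = tvar q)
    (hb : φ (MvPolynomial.X (Sum.inl b)) = tvar p / tvar q * fvar b) :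
    IsReversed φ (Sum.inl b) := by
  refine ⟨MvPolynomial.X (Sum.inr p) * MvPolynomial.X (Sum.inl b),
    MvPolynomial.X (Sum.inr q), ?_, ?_, ?_⟩
  · rw [hq]
    exact tvar_ne_zero p
  · rw [hb, map_mul]
    exact div_mul_mul_cancel_of_ne (tvar_ne_zero q) _ _
  · rw [hq, map_mul, hp, hb]
    exact mul_eq_mul_div_mul (tvar_ne_zero q) _ _

section SimpleVal

variable {m n : ℕ} (hmn : m < n) (ω : UpperHalfPlane) (i : Fin n)

theorem simpleVal_zero_f (hi : (i : ℕ) = 0) (a : Fin m) :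
    simpleVal hmn ω i (Sum.inl a) = 1 / fvar a := by
  simp only [simpleVal]
  rw [if_pos hi]

theorem simpleVal_zero_tau (hi : (i : ℕ) = 0) (a : Fin n) (ha : (a : ℕ) < m) :
    simpleVal hmn ω i (Sum.inr a) = fvar ⟨a, ha⟩ * tvar a := by
  simp only [simpleVal]
  rw [if_pos hi, dif_pos ha]

theorem simpleVal_zero_tau_fix (hi : (i : ℕ) = 0) (a : Fin n) (ha : m ≤ (a : ℕ)) :
    simpleVal hmn ω i (Sum.inr a) = tvar a := by
  simp only [simpleVal]
  rw [if_pos hi, dif_neg (by omega)]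

theorem simpleVal_tau (hi : 1 ≤ (i : ℕ)) (a : Fin n) :
    simpleVal hmn ω i (Sum.inr a) = tvar (Equiv.swap (⟨i - 1, by omega⟩ : Fin n) i a) := by
  simp only [simpleVal]
  rw [if_neg (by omega)]

theorem simpleVal_f_lt (hi : 1 ≤ (i : ℕ)) (h : (i : ℕ) < m) (a : Fin m) :
    simpleVal hmn ω i (Sum.inl a) =
      fvar (Equiv.swap (⟨i - 1, by omega⟩ : Fin m) ⟨i, h⟩ a) := by
  simp only [simpleVal]
  rw [if_neg (by omega), dif_pos h]

theorem simpleVal_f_mid (hi : 1 ≤ (i : ℕ)) (h : (i : ℕ) = m) (a b : Fin m) (ha : (a : ℕ) + 1 < m)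
    (hb : (b : ℕ) + 1 = m) :
    simpleVal hmn ω i (Sum.inl a) = tvar (b.castLE hmn.le) / tvar ⟨m, hmn⟩ *
      (cc hmn ω a b * fvar a + cc hmn ω b a * fvar b) := by
  obtain rfl : b = ⟨m - 1, Nat.sub_lt a.pos Nat.one_pos⟩ := Fin.ext (by simp; omega)
  simp only [simpleVal]
  rw [if_neg (by omega), dif_neg (by omega), if_pos h, if_pos ha]
  rfl

theorem simpleVal_f_mid_last (hi : 1 ≤ (i : ℕ)) (h : (i : ℕ) = m) (b : Fin m)
    (hb : (b : ℕ) + 1 = m) :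
    simpleVal hmn ω i (Sum.inl b) = tvar (b.castLE hmn.le) / tvar ⟨m, hmn⟩ * fvar b := by
  have hm : 0 < m := b.pos
  obtain rfl : b = ⟨m - 1, Nat.sub_lt hm Nat.one_pos⟩ := Fin.ext (by simp; omega)
  simp only [simpleVal]
  rw [if_neg (by omega), dif_neg (by omega), if_pos h, if_neg (by omega)]
  rfl

theorem simpleVal_f_gt (h : m < (i : ℕ)) (a : Fin m) :
    simpleVal hmn ω i (Sum.inl a) = fvar a := by
  simp only [simpleVal]
  rw [if_neg (by omega), dif_neg (by omega), if_neg (by omega)]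

end SimpleVal

theorem exists_mid_ratio {m n : ℕ} (hmn : m < n) (ω : UpperHalfPlane) (a b : Fin m)
    (ha : (a : ℕ) + 1 < m) (hb : (b : ℕ) + 1 = m) (θ : Mero n →+* Mero n)
    (hθ : ∀ g : Entire n, θ (algebraMap _ _ g) = algebraMap _ _ (pullback (refl m ⟨m, hmn⟩) g)) :
    ∃ c₁ c₂ : Mero n, meroCoeff m n c₁ = cc hmn ω a b ∧ meroCoeff m n c₂ = cc hmn ω b a ∧
      meroCoeff m n (θ c₁) * meroCoeff m n c₁ = 1 ∧
      meroCoeff m n (θ c₁) * meroCoeff m n c₂ + meroCoeff m n (θ c₂) = 0 := by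
  have hm : 1 ≤ m := by omega
  have hb' : b.castLE hmn.le = ⟨m - 1, by omega⟩ := Fin.ext (by simp; omega)
  have h1 : (pt (a.castLE hmn.le) - pt (b.castLE hmn.le) : Lat n) ≠ 0 :=
    pt_sub_pt_ne_zero fun h => by
      have := congrArg Fin.val h
      simp only [Fin.val_castLE] at this
      omega
  have h2 : (pt (a.castLE hmn.le) - pt ⟨m, hmn⟩ : Lat n) ≠ 0 :=
    pt_sub_pt_ne_zero fun h => by
      have := congrArg Fin.val h
      simp only [Fin.val_castLE] at this
      omega
  have e1 : refl m ⟨m, hmn⟩ (pt (a.castLE hmn.le) : Lat n) = pt (a.castLE hmn.le) := by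
    rw [refl_pos_pt m _ _ hm, Equiv.swap_apply_of_ne_of_ne]
    · intro h
      have := congrArg Fin.val h
      simp only [Fin.val_castLE] at this
      omega
    · intro h
      have := congrArg Fin.val h
      simp only [Fin.val_castLE] at this
      omega
  have e2 : refl m ⟨m, hmn⟩ (pt (b.castLE hmn.le) : Lat n) = pt ⟨m, hmn⟩ := by
    rw [refl_pos_pt m _ _ hm, hb', Equiv.swap_apply_left]
  have e3 : refl m ⟨m, hmn⟩ (pt ⟨m, hmn⟩ : Lat n) = pt (b.castLE hmn.le) := by
    rw [refl_pos_pt m _ _ hm, hb', Equiv.swap_apply_right]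
  have e4 : refl m ⟨m, hmn⟩ (root m ⟨0, by omega⟩ : Lat n) =
      root m ⟨0, by omega⟩ + (pt (b.castLE hmn.le) - pt ⟨m, hmn⟩) := by
    rw [refl_pos_root_zero m hmn _ _ hm rfl, if_pos rfl, root_pos_eq m ⟨m, hmn⟩ hm, hb']
  have hra := root_zero_ne_zero (n := n) m ⟨0, by omega⟩ rfl
  have hra' := root_zero_add_ne_zero (n := n) m ⟨0, by omega⟩ (b.castLE hmn.le) ⟨m, hmn⟩ rfl
  obtain ⟨c₁, hc₁, hc₁'⟩ := meroCoeff_ratio m ω (pt (a.castLE hmn.le) : Lat n)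
    (pt (b.castLE hmn.le)) (pt ⟨m, hmn⟩) (root m ⟨0, by omega⟩)
  obtain ⟨c₂, hc₂, hc₂'⟩ := meroCoeff_ratio m ω (pt (b.castLE hmn.le) : Lat n)
    (pt (a.castLE hmn.le)) (pt ⟨m, hmn⟩) (root m ⟨0, by omega⟩)
  have hd₁ := hc₁' θ _ hθ
  have hd₂ := hc₂' θ _ hθ
  rw [e1, e2, e3, e4] at hd₁ hd₂
  refine ⟨c₁, c₂, hc₁, hc₂, ?_, ?_⟩
  · rw [hd₁, hc₁]
    exact ratio_mul_ratio m ω h1 h2 hra hra'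
  · rw [hd₁, hd₂, hc₂]
    exact ratio_mul_ratio_add m ω h1 h2 hra hra'

theorem isReversed_simpleVal {m n : ℕ} (hm : 0 < m) (hmn : m < n) (ω : UpperHalfPlane) (i : Fin n)
    (θ : Mero n →+* Mero n)
    (hθ : ∀ g : Entire n, θ (algebraMap _ _ g) = algebraMap _ _ (pullback (refl m i) g))
    (φ : MvPolynomial (Fin m ⊕ Fin n) (Mero n) →+* RatField m n)
    (hC : ∀ c, φ (MvPolynomial.C c) = meroCoeff m n (θ c))
    (hX : ∀ s, φ (MvPolynomial.X s) = simpleVal hmn ω i s) (s : Fin m ⊕ Fin n) :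
    IsReversed φ s := by
  rcases Nat.eq_zero_or_pos i with hi | hi
  · have hf := fun a => (hX (Sum.inl a)).trans (simpleVal_zero_f hmn ω i hi a)
    rcases s with a | a
    · exact isReversed_of_inv (hf a)
    by_cases ha : (a : ℕ) < m
    · exact isReversed_of_mul (hf ⟨a, ha⟩)
        ((hX (Sum.inr a)).trans (simpleVal_zero_tau hmn ω i hi a ha))
    · have h := (hX (Sum.inr a)).trans (simpleVal_zero_tau_fix hmn ω i hi a (by omega))
      exact isReversed_of_polynomial (MvPolynomial.X (Sum.inr a)) h h
  have ht := fun a => (hX (Sum.inr a)).trans (simpleVal_tau hmn ω i hi a)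
  rcases s with a | a
  · rcases lt_trichotomy (i : ℕ) m with him | him | him
    · have hf := fun a => (hX (Sum.inl a)).trans (simpleVal_f_lt hmn ω i hi him a)
      refine isReversed_of_polynomial (MvPolynomial.X (Sum.inl _)) (hf a) ?_
      rw [hf, Equiv.swap_apply_self]
      rfl
    · obtain rfl : i = ⟨m, hmn⟩ := Fin.ext him
      let b : Fin m := ⟨m - 1, Nat.sub_lt hm Nat.one_pos⟩
      have hb : (b : ℕ) + 1 = m := Nat.sub_add_cancel hm
      have hlast := fun b hb => (hX (Sum.inl b)).trans (simpleVal_f_mid_last hmn ω _ hi him b hb)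
      have hq : φ (MvPolynomial.X (Sum.inr ⟨m, hmn⟩)) = tvar (b.castLE hmn.le) := by
        rw [ht, Equiv.swap_apply_right]
        rfl
      have hp : φ (MvPolynomial.X (Sum.inr (b.castLE hmn.le))) = tvar ⟨m, hmn⟩ :=
        (ht _).trans (congrArg tvar (Equiv.swap_apply_left _ _))
      by_cases ha : (a : ℕ) + 1 < m
      · obtain ⟨c₁, c₂, h1, h2, h3, h4⟩ := exists_mid_ratio hmn ω a b ha hb θ hθ
        have hv := (hX (Sum.inl a)).trans (simpleVal_f_mid hmn ω _ hi him a b ha hb)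
        rw [← h1, ← h2] at hv
        exact isReversed_of_ratio hC h3 h4 hq hp hv (hlast b hb)
      · have hab : a = b := Fin.ext (by omega)
        rw [hab]
        exact isReversed_of_div hq hp (hlast b hb)
    · have hf := (hX (Sum.inl a)).trans (simpleVal_f_gt hmn ω i him a)
      exact isReversed_of_polynomial (MvPolynomial.X (Sum.inl a)) hf hf
  · refine isReversed_of_polynomial (MvPolynomial.X (Sum.inr _)) (ht a) ?_
    rw [ht, Equiv.swap_apply_self]
    rfl

theorem exists_isSimple {m n : ℕ} (hm : 0 < m) (hmn : m < n) (ω : UpperHalfPlane) (i : Fin n) :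
    ∃ σ : RatField m n ≃+* RatField m n, IsSimple hmn ω i σ ∧ ∀ x, σ (σ x) = x := by
  obtain ⟨θ, hθ, hθθ⟩ := exists_meroEquiv (refl m i) (refl_mul_self m hmn i)
  let φ : MvPolynomial (Fin m ⊕ Fin n) (Mero n) →+* RatField m n :=
    MvPolynomial.eval₂Hom ((meroCoeff m n).comp θ) (simpleVal hmn ω i)
  have hC : ∀ c, φ (MvPolynomial.C c) = meroCoeff m n (θ c) := fun c =>
    MvPolynomial.eval₂Hom_C _ _ c
  have hX : ∀ s, φ (MvPolynomial.X s) = simpleVal hmn ω i s := fun s =>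
    MvPolynomial.eval₂Hom_X' _ _ s
  have hs := isReversed_simpleVal hm hmn ω i θ hθ φ hC hX
  simp only [IsReversed, hX] at hs
  obtain ⟨σ, hσC, hσX, hσ⟩ :=
    exists_ringEquiv_of_involutive θ hθθ (simpleVal hmn ω i) φ hC hX hs
  have hf : ∀ a, σ (fvar a) = simpleVal hmn ω i (Sum.inl a) := fun a => hσX (Sum.inl a)
  have ht : ∀ a, σ (tvar a) = simpleVal hmn ω i (Sum.inr a) := fun a => hσX (Sum.inr a)
  refine ⟨σ, ⟨fun g => (hσC _).trans (congrArg (meroCoeff m n) (hθ g)),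
    fun h a => (ht _).trans (simpleVal_zero_tau hmn ω i h _ a.2),
    fun h a ha => (ht _).trans (simpleVal_zero_tau_fix hmn ω i h a ha),
    fun h a => (ht _).trans (simpleVal_tau hmn ω i h a),
    fun h a => (hf _).trans (simpleVal_zero_f hmn ω i h a),
    fun h h' a => (hf _).trans (simpleVal_f_lt hmn ω i h h' a),
    fun h a b ha hb => (hf _).trans (simpleVal_f_mid hmn ω i (h ▸ hm) h a b ha hb),
    fun h b hb => (hf _).trans (simpleVal_f_mid_last hmn ω i (h ▸ hm) h b hb),
    fun h a => (hf _).trans (simpleVal_f_gt hmn ω i h a)⟩, hσ⟩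

end

end EllipticTau
namespace EllipticTau

noncomputable section

attribute [local instance] ratField_nontrivial ratFieldField ratField_neZero_one

/-! ### The subgroup of permutations -/

/-- The theta function `[x - ε_a - α₀] ∏_{b ≠ a} [x - ε_b]`, for a constant `x`; the product is over
the indices `1, …, m`. -/
def basisTheta {m n : ℕ} (hmn : m < n) (ω : UpperHalfPlane) (x : ℂ) (a : Fin m) : Entire n :=
  ∏ b : Fin m, shiftedBracket ω x
    (pt (b.castLE hmn.le) + if b = a then root m (⟨0, by omega⟩ : Fin n) else 0)

/-- The product `τ₁ ⋯ τ_m`. -/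
def tauProd {m n : ℕ} (hmn : m < n) : RatField m n := ∏ b : Fin m, tvar (b.castLE hmn.le)

theorem tauProd_ne_zero {m n : ℕ} (hmn : m < n) : tauProd (m := m) hmn ≠ 0 :=
  Finset.prod_ne_zero_iff.mpr fun _ _ => tvar_ne_zero _

theorem basisTheta_apply {m n : ℕ} (hmn : m < n) (ω : UpperHalfPlane) (x : ℂ) (a : Fin m)
    (ε : Fin (n + 1) → ℂ) : (basisTheta hmn ω x a).1 ε = ∏ b : Fin m, theta11 ω (x - linForm
      (pt (b.castLE hmn.le) + if b = a then root m (⟨0, by omega⟩ : Fin n) else 0) ε) := by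
  rw [basisTheta, SubmonoidClass.coe_finsetProd, Finset.prod_apply]
  rfl

/-- Lagrange interpolation: at `x = ε_a` every `Θ_b` with `b ≠ a` contains the factor `[0] = 0`,
while `Θ_a` becomes `[-α_0] ∏_{b ≠ a} [ε_a - ε_b]`, a nonzero element of a domain. -/
theorem eq_zero_of_sum_mul_basisTheta_eq_zero {m n : ℕ} (hmn : m < n) (ω : UpperHalfPlane)
    (g : Fin m → Entire n) (h : ∀ x, ∑ b, g b * basisTheta hmn ω x b = 0) (a : Fin m) :
    g a = 0 := by
  have hne : bracket ω (-root m (⟨0, by omega⟩ : Fin n)) *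
      ∏ b ∈ Finset.univ.erase a, bracket ω (pt (a.castLE hmn.le) - pt (b.castLE hmn.le) : Lat n) ≠
        0 := by
    refine mul_ne_zero (bracket_ne_zero ω (neg_ne_zero.mpr (root_zero_ne_zero m _ rfl)))
      (Finset.prod_ne_zero_iff.mpr fun b hb => bracket_ne_zero ω (pt_sub_pt_ne_zero fun hab => ?_))
    have := congrArg Fin.val hab
    exact Finset.ne_of_mem_erase hb (Fin.ext this.symm)
  refine (mul_eq_zero.mp (Subtype.ext (funext fun ε => ?_))).resolve_right hne
  -- The constant `x` is chosen afresh for each point `ε`.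
  have h1 := congrFun (congrArg Subtype.val (h (linForm (pt (a.castLE hmn.le)) ε))) ε
  rw [AddSubmonoidClass.coe_finsetSum, Finset.sum_apply, Finset.sum_eq_single a] at h1
  · refine Eq.trans ?_ h1
    change (g a).1 ε * _ = (g a).1 ε * _
    congr 1
    rw [basisTheta_apply, ← Finset.mul_prod_erase _ _ (Finset.mem_univ a)]
    refine congrArg₂ (fun p q : ℂ => p * q) ?_ ?_
    · rw [if_pos rfl, linForm_add, sub_add_cancel_left, ← linForm_neg]
      rfl
    · rw [SubmonoidClass.coe_finsetProd, Finset.prod_apply]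
      refine Finset.prod_congr rfl fun b hb => ?_
      rw [if_neg (Finset.ne_of_mem_erase hb), add_zero, ← linForm_sub]
      rfl
  · intro b _ hb
    change (g b).1 ε * _ = 0
    rw [basisTheta_apply, Finset.prod_eq_zero (Finset.mem_univ a), mul_zero]
    rw [if_neg hb.symm, add_zero, sub_self, theta11_zero]
  · exact fun ha => absurd (Finset.mem_univ a) ha

theorem eq_zero_of_sum_meroCoeff_mul_eq_zero {m n : ℕ} (hmn : m < n) (ω : UpperHalfPlane)
    (r : Fin m → Mero n)
    (h : ∀ x, ∑ b, meroCoeff m n (r b) * coeff m (basisTheta hmn ω x b) = 0) (a : Fin m) :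
    r a = 0 := by
  obtain ⟨d, hd⟩ := IsLocalization.exist_integer_multiples_of_finite
    (nonZeroDivisors (Entire n)) r
  choose g hg using hd
  have hd0 : algebraMap (Entire n) (Mero n) d ≠ 0 :=
    IsFractionRing.to_map_ne_zero_of_mem_nonZeroDivisors d.2
  have hg' : ∀ b, algebraMap (Entire n) (Mero n) (g b) = algebraMap _ _ d.1 * r b := fun b =>
    (hg b).trans (Algebra.smul_def _ _)
  have h0 : g a = 0 := by
    refine eq_zero_of_sum_mul_basisTheta_eq_zero hmn ω g (fun x => ?_) a
    refine (map_eq_zero_iff _ (coeffHom_injective m n)).mp ?_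
    rw [map_sum]
    refine Eq.trans ?_ ((congrArg (meroCoeff m n (algebraMap _ _ d.1) * ·) (h x)).trans
      (mul_zero _))
    rw [Finset.mul_sum]
    refine Finset.sum_congr rfl fun b _ => ?_
    have hgb : coeffHom m n (g b) = meroCoeff m n (algebraMap _ _ d.1) * meroCoeff m n (r b) :=
      (congrArg (meroCoeff m n) (hg' b)).trans (map_mul _ _ _)
    rw [map_mul, hgb, mul_assoc]
    rfl
  have h1 := hg' a
  rw [h0, map_zero] at h1
  exact (mul_eq_zero.mp h1.symm).resolve_left hd0

/-- The matrix of a composite is the `σ`-twist of one matrix times the other. It does not involve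
`y` and `z`, so the same new matrix serves for the products `f_a τ_1 ⋯ τ_m` and for the theta
functions. -/
theorem map_sum_semilinear {K F ι : Type*} [Fintype ι] [Field K] [Field F] (κ : K →+* F)
    (σ : F ≃+* F) (r' c : ι → K) (r : ι → ι → K) (hc : ∀ b, σ (κ (r' b)) = κ (c b)) (y z : ι → F)
    (hyz : ∀ b, σ (y b) = ∑ d, κ (r b d) * z d) :
    σ (∑ b, κ (r' b) * y b) = ∑ d, κ (∑ b, c b * r b d) * z d := by
  rw [map_sum, Finset.sum_congr rfl fun b _ => by rw [map_mul, hc, hyz, Finset.mul_sum],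
    Finset.sum_comm]
  refine Finset.sum_congr rfl fun d _ => ?_
  rw [map_sum, Finset.sum_mul]
  refine Finset.sum_congr rfl fun b _ => ?_
  rw [map_mul, mul_assoc]

/-- The automorphism `σ` acts on the coefficients through `T`, permutes the `τ`'s as `T` permutes
the basis vectors, and transforms the products `f_a τ₁ ⋯ τ_m` by the same matrix as the theta
functions `basisTheta`. -/
structure IsCompatible {m n : ℕ} (hmn : m < n) (ω : UpperHalfPlane)
    (σ : RatField m n ≃+* RatField m n) (T : Module.End ℤ (Lat n)) : Prop where
  on_coeff : ∀ g : Entire n, σ (coeff m g) = coeff m (pullback T g)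
  on_tau : ∀ a : Fin n, ∃ b : Fin n, T (pt a) = pt b ∧ σ (tvar a) = tvar b
  on_f : ∀ a : Fin m, ∃ r : Fin m → Mero n,
    σ (fvar a * tauProd hmn) = ∑ b, meroCoeff m n (r b) * (fvar b * tauProd hmn) ∧
    ∀ x, σ (coeff m (basisTheta hmn ω x a)) =
      ∑ b, meroCoeff m n (r b) * coeff m (basisTheta hmn ω x b)

theorem exists_map_meroCoeff {m n : ℕ} {σ : RatField m n ≃+* RatField m n}
    {T : Module.End ℤ (Lat n)} (h : ∀ g, σ (coeff m g) = coeff m (pullback T g)) (c : Mero n) :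
    ∃ c', σ (meroCoeff m n c) = meroCoeff m n c' := by
  obtain ⟨a, b, -, rfl⟩ := IsFractionRing.div_surjective (A := Entire n) c
  refine ⟨algebraMap _ _ (pullback T a) / algebraMap _ _ (pullback T b), ?_⟩
  rw [map_div₀, map_div₀, map_div₀]
  exact congrArg₂ (· / ·) (h a) (h b)

section IsCompatible

variable {m n : ℕ} {hmn : m < n} {ω : UpperHalfPlane} {σ σ' : RatField m n ≃+* RatField m n}
  {T T' : Module.End ℤ (Lat n)}

theorem IsCompatible.one : IsCompatible hmn ω (1 : RatField m n ≃+* RatField m n) 1 where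
  on_coeff g := by rw [pullback_one]; rfl
  on_tau a := ⟨a, rfl, rfl⟩
  on_f a := by
    refine ⟨Pi.single a 1, ?_, fun x => ?_⟩
    all_goals
      rw [Finset.sum_eq_single a, Pi.single_eq_same, map_one, one_mul]
      · rfl
      · intro b _ hb
        rw [Pi.single_eq_of_ne hb, map_zero, zero_mul]
      · exact fun ha => absurd (Finset.mem_univ a) ha

theorem on_coeff_mul (h : ∀ g, σ (coeff m g) = coeff m (pullback T g))
    (h' : ∀ g, σ' (coeff m g) = coeff m (pullback T' g)) (g : Entire n) :
    (σ * σ') (coeff m g) = coeff m (pullback (T * T') g) := by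
  rw [pullback_mul, ← h, ← h']
  rfl

theorem IsCompatible.mul (h : IsCompatible hmn ω σ T) (h' : IsCompatible hmn ω σ' T') :
    IsCompatible hmn ω (σ * σ') (T * T') where
  on_coeff := on_coeff_mul h.on_coeff h'.on_coeff
  on_tau a := by
    obtain ⟨b, h1, h2⟩ := h'.on_tau a
    obtain ⟨c, h3, h4⟩ := h.on_tau b
    exact ⟨c, (congrArg T h1).trans h3, (congrArg σ h2).trans h4⟩
  on_f a := by
    obtain ⟨r', h1, h2⟩ := h'.on_f a
    choose r h3 h4 using h.on_f
    choose c hc using fun b => exists_map_meroCoeff h.on_coeff (r' b)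
    have key := fun y z => map_sum_semilinear (meroCoeff m n) σ r' c r hc y z
    refine ⟨fun d => ∑ b, c b * r b d, ?_, fun x => ?_⟩
    · exact (congrArg σ h1).trans (key _ _ h3)
    · exact (congrArg σ (h2 x)).trans (key _ _ fun b => h4 b x)

theorem IsCompatible.pow (h : IsCompatible hmn ω σ T) (k : ℕ) :
    IsCompatible hmn ω (σ ^ k) (T ^ k) := by
  induction k with
  | zero => rw [pow_zero, pow_zero]; exact IsCompatible.one
  | succ k ih => rw [pow_succ, pow_succ]; exact ih.mul h

/-- A trivial lattice action fixes the coefficients, and it fixes the `τ_a` because the `e_a` are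
distinct. It also fixes every `Θ_a`, so independence forces the common matrix to be the identity,
and therefore the `f_a` are fixed. -/
theorem IsCompatible.eq_one (h : IsCompatible hmn ω σ 1) : σ = 1 := by
  have ht : ∀ a, σ (tvar a) = tvar a := by
    intro a
    obtain ⟨b, h1, h2⟩ := h.on_tau a
    rw [h2, pt_injective h1]
  have hc : ∀ g, σ (coeff m g) = coeff m g := fun g => by rw [h.on_coeff, pullback_one]
  refine ringEquiv_ext hc (fun a => ?_) ht
  obtain ⟨r, h1, h2⟩ := h.on_f a
  have hr : ∀ b, r b - (Pi.single a 1 : Fin m → Mero n) b = 0 := by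
    refine eq_zero_of_sum_meroCoeff_mul_eq_zero hmn ω _ fun x => ?_
    simp only [map_sub, sub_mul, Finset.sum_sub_distrib]
    rw [← h2 x, hc, sub_eq_zero, Finset.sum_eq_single a, Pi.single_eq_same, map_one, one_mul]
    · intro b _ hb
      rw [Pi.single_eq_of_ne hb, map_zero, zero_mul]
    · exact fun ha => absurd (Finset.mem_univ a) ha
  have hp : σ (tauProd hmn) = tauProd hmn := by
    rw [tauProd, map_prod]
    exact Finset.prod_congr rfl fun b _ => ht _
  rw [map_mul, hp, Finset.sum_eq_single a, sub_eq_zero.mp (hr a), Pi.single_eq_same, map_one,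
    one_mul] at h1
  · exact mul_right_cancel₀ (tauProd_ne_zero hmn) h1
  · intro b _ hb
    rw [sub_eq_zero.mp (hr b), Pi.single_eq_of_ne hb, map_zero, zero_mul]
  · exact fun ha => absurd (Finset.mem_univ a) ha

end IsCompatible

/-! ### Compatibility of `s_1, …, s_{n-1}` with the theta functions -/

theorem pullback_basisTheta {m n : ℕ} (hmn : m < n) (ω : UpperHalfPlane)
    (T : Module.End ℤ (Lat n)) (x : ℂ) (a : Fin m) :
    pullback T (basisTheta hmn ω x a) = ∏ b : Fin m, shiftedBracket ω x
      (T (pt (b.castLE hmn.le)) + if b = a then T (root m (⟨0, by omega⟩ : Fin n)) else 0) := by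
  rw [basisTheta, map_prod]
  refine Finset.prod_congr rfl fun b _ => ?_
  rw [pullback_shiftedBracket, map_add, apply_ite T, map_zero]

theorem shiftedBracket_three_term {n : ℕ} (ω : UpperHalfPlane) (x : ℂ) (u v w A : Lat n) :
    bracket ω (u - v) * bracket ω A *
        (shiftedBracket ω x (u + (A + (v - w))) * shiftedBracket ω x w) =
      bracket ω (u - w) * bracket ω (A + v - w) *
        (shiftedBracket ω x (u + A) * shiftedBracket ω x v) -
      bracket ω (v - w) * bracket ω (A + u - w) *
        (shiftedBracket ω x (v + A) * shiftedBracket ω x u) := by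
  refine Subtype.ext (funext fun ε => ?_)
  have h := theta11_three_term ω.im_pos x (linForm u ε) (linForm v ε) (linForm w ε) (linForm A ε)
  simp only [← linForm_add, ← linForm_sub, sub_sub] at h
  rw [← add_sub_assoc A v w]
  exact h

theorem eq_div_mul_add_of_mul_eq_sub {F : Type*} [Field F] {p q X Y Z s t : F} (hp : p ≠ 0)
    (hq : q ≠ 0) (h : p * q * X = s * Y - t * Z) :
    X = s / (p * q) * Y + t / (-p * q) * Z := by
  field_simp
  linear_combination h

/-- Division by `[u - v] [A]` turns the coefficients of the three-term identity into `c_{a,m}` and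
`c_{m,a}`; the minus sign is absorbed by `[v - u] = -[u - v]`. -/
theorem coeff_shiftedBracket_three_term {m n : ℕ} (ω : UpperHalfPlane) (x : ℂ) {u v w A : Lat n}
    (huv : u - v ≠ 0) (hA : A ≠ 0) :
    coeff m (shiftedBracket ω x (u + (A + (v - w))) * shiftedBracket ω x w) =
      ratio m ω u v w A * coeff m (shiftedBracket ω x (u + A) * shiftedBracket ω x v) +
      ratio m ω v u w A * coeff m (shiftedBracket ω x (v + A) * shiftedBracket ω x u) := by
  have h := congrArg (coeffHom m n) (shiftedBracket_three_term ω x u v w A)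
  simp only [map_mul, map_sub] at h
  have h1 := eq_div_mul_add_of_mul_eq_sub (br_ne_zero m ω huv) (br_ne_zero m ω hA) h
  rw [ratio, ratio, ← neg_sub u v, br_neg]
  simp only [coeff_eq, map_mul]
  exact h1

theorem sum_single_mul {m n : ℕ} (a : Fin m) (y : Fin m → RatField m n) :
    ∑ b, meroCoeff m n ((Pi.single a 1 : Fin m → Mero n) b) * y b = y a := by
  rw [Finset.sum_eq_single a, Pi.single_eq_same, map_one, one_mul]
  · intro b _ hb
    rw [Pi.single_eq_of_ne hb, map_zero, zero_mul]
  · exact fun ha => absurd (Finset.mem_univ a) ha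

theorem sum_ite_mul {m n : ℕ} {a l : Fin m} (hal : a ≠ l) (c₁ c₂ : Mero n)
    (y : Fin m → RatField m n) :
    ∑ b, meroCoeff m n (if b = a then c₁ else if b = l then c₂ else 0) * y b =
      meroCoeff m n c₁ * y a + meroCoeff m n c₂ * y l := by
  rw [Fintype.sum_eq_add a l hal, if_pos rfl, if_neg hal.symm, if_pos rfl]
  rintro b ⟨h1, h2⟩
  rw [if_neg h1, if_neg h2, map_zero, zero_mul]

theorem prod_eq_mul_mul_prod_erase {m : ℕ} {R : Type*} [CommMonoid R] {a l : Fin m} (hal : a ≠ l)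
    (F : Fin m → R) : ∏ b, F b = F a * F l * ∏ b ∈ (Finset.univ.erase a).erase l, F b := by
  rw [← Finset.mul_prod_erase _ _ (Finset.mem_univ a),
    ← Finset.mul_prod_erase _ _ (Finset.mem_erase.mpr ⟨hal.symm, Finset.mem_univ l⟩), mul_assoc]

section OnF

variable {m n : ℕ} {i : Fin n}

theorem swap_castLE_of_lt (hmn : m < n) (him : (i : ℕ) < m) (b : Fin m) :
    Equiv.swap (⟨i - 1, by omega⟩ : Fin n) i (b.castLE hmn.le) =
      (Equiv.swap (⟨i - 1, by omega⟩ : Fin m) ⟨i, him⟩ b).castLE hmn.le :=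
  ((Fin.castLE_injective hmn.le).swap_apply (⟨i - 1, by omega⟩ : Fin m) ⟨i, him⟩ b)

theorem swap_castLE_of_ne (hmn : m < n) (b : Fin m) (h1 : (b : ℕ) ≠ i - 1) (h2 : (b : ℕ) ≠ i) :
    Equiv.swap (⟨i - 1, by omega⟩ : Fin n) i (b.castLE hmn.le) = b.castLE hmn.le :=
  Equiv.swap_apply_of_ne_of_ne (fun h => h1 (congrArg Fin.val h)) fun h => h2 (congrArg Fin.val h)

theorem swap_castLE_last (hmn : m < n) (l : Fin m) (hl : (l : ℕ) + 1 = m) :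
    Equiv.swap (⟨m - 1, by omega⟩ : Fin n) ⟨m, hmn⟩ (l.castLE hmn.le) = ⟨m, hmn⟩ := by
  have h : l.castLE hmn.le = (⟨m - 1, by omega⟩ : Fin n) := Fin.ext (by simp; omega)
  rw [h, Equiv.swap_apply_left]

theorem refl_mid_root_zero (hmn : m < n) (l : Fin m) (hl : (l : ℕ) + 1 = m) :
    refl m ⟨m, hmn⟩ (root m (⟨0, by omega⟩ : Fin n)) =
      root m (⟨0, by omega⟩ : Fin n) + (pt (l.castLE hmn.le) - pt ⟨m, hmn⟩) := by
  have h : l.castLE hmn.le = (⟨m - 1, by omega⟩ : Fin n) := Fin.ext (by simp; omega)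
  have hm : 1 ≤ ((⟨m, hmn⟩ : Fin n) : ℕ) := by simp; omega
  rw [refl_pos_root_zero m hmn _ _ hm rfl, if_pos rfl, root_pos_eq m _ hm, h]

theorem div_mul_mul_cancel_of_ne' {F : Type*} [Field F] {t : F} (ht : t ≠ 0) (t' x : F) :
    t' / t * (t * x) = t' * x := by
  field_simp

variable {hmn : m < n} {ω : UpperHalfPlane} {σ : RatField m n ≃+* RatField m n}

theorem IsSimple.map_tauProd (h : IsSimple hmn ω i σ) (hi : 1 ≤ (i : ℕ)) :
    σ (tauProd hmn) =
      ∏ b : Fin m, tvar (Equiv.swap (⟨i - 1, by omega⟩ : Fin n) i (b.castLE hmn.le)) :=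
  (map_prod σ _ _).trans (Finset.prod_congr rfl fun _ _ => h.tau hi _)

theorem IsSimple.map_basisTheta (h : IsSimple hmn ω i σ) (hi : 1 ≤ (i : ℕ)) (x : ℂ) (a : Fin m) :
    σ (coeff m (basisTheta hmn ω x a)) = coeff m (∏ b : Fin m, shiftedBracket ω x
      (pt (Equiv.swap (⟨i - 1, by omega⟩ : Fin n) i (b.castLE hmn.le)) +
        if b = a then refl m i (root m (⟨0, by omega⟩ : Fin n)) else 0)) := by
  rw [h.on_coeff, subst_eq_pullback, pullback_basisTheta]
  simp only [refl_pos_pt m i _ hi]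

theorem IsSimple.on_f_lt (h : IsSimple hmn ω i σ) (hi : 1 ≤ (i : ℕ)) (him : (i : ℕ) < m)
    (a : Fin m) : ∃ r : Fin m → Mero n,
      σ (fvar a * tauProd hmn) = ∑ b, meroCoeff m n (r b) * (fvar b * tauProd hmn) ∧
      ∀ x, σ (coeff m (basisTheta hmn ω x a)) =
        ∑ b, meroCoeff m n (r b) * coeff m (basisTheta hmn ω x b) := by
  refine ⟨Pi.single (Equiv.swap (⟨i - 1, by omega⟩ : Fin m) ⟨i, him⟩ a) 1, ?_, fun x => ?_⟩
  · rw [sum_single_mul _ fun b => fvar b * tauProd hmn, map_mul, h.f_lt hi him, h.map_tauProd hi]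
    congr 1
    exact (Finset.prod_congr rfl fun b _ => congrArg tvar (swap_castLE_of_lt hmn him b)).trans
      (Equiv.prod_comp (Equiv.swap (⟨i - 1, by omega⟩ : Fin m) ⟨i, him⟩)
        fun b => tvar (b.castLE hmn.le))
  · rw [sum_single_mul _ fun b => coeff m (basisTheta hmn ω x b), h.map_basisTheta hi,
      refl_pos_root_zero m hmn i ⟨0, by omega⟩ hi rfl, if_neg him.ne]
    congr 1
    refine Eq.trans (Finset.prod_congr rfl fun b _ => ?_)
      (Equiv.prod_comp (Equiv.swap (⟨i - 1, by omega⟩ : Fin m) ⟨i, him⟩)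
        fun b => shiftedBracket ω x (pt (b.castLE hmn.le) +
          if b = Equiv.swap (⟨i - 1, by omega⟩ : Fin m) ⟨i, him⟩ a then
            root m (⟨0, by omega⟩ : Fin n) else 0))
    simp only [swap_castLE_of_lt hmn him, Equiv.apply_eq_iff_eq]

theorem IsSimple.on_f_gt (h : IsSimple hmn ω i σ) (him : m < (i : ℕ)) (a : Fin m) :
    ∃ r : Fin m → Mero n,
      σ (fvar a * tauProd hmn) = ∑ b, meroCoeff m n (r b) * (fvar b * tauProd hmn) ∧
      ∀ x, σ (coeff m (basisTheta hmn ω x a)) =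
        ∑ b, meroCoeff m n (r b) * coeff m (basisTheta hmn ω x b) := by
  have hi : 1 ≤ (i : ℕ) := by omega
  have hs := fun b : Fin m => swap_castLE_of_ne (i := i) hmn b (by omega) (by omega)
  refine ⟨Pi.single a 1, ?_, fun x => ?_⟩
  · rw [sum_single_mul _ fun b => fvar b * tauProd hmn, map_mul, h.f_gt him, h.map_tauProd hi]
    congr 1
    exact Finset.prod_congr rfl fun b _ => congrArg tvar (hs b)
  · rw [sum_single_mul _ fun b => coeff m (basisTheta hmn ω x b), h.map_basisTheta hi,
      refl_pos_root_zero m hmn i ⟨0, by omega⟩ hi rfl, if_neg him.ne']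
    congr 1
    exact Finset.prod_congr rfl fun b _ => by rw [hs b]

/-- In the product `τ_1 ⋯ τ_m`, `s_m` replaces `τ_m` by `τ_{m+1}`, and the prefactor in the formulas
for `s_m(f_a)` undoes this. For this reason `f_a τ_1 ⋯ τ_m`, unlike `f_a`, transforms linearly over
`K`. -/
theorem IsSimple.mid_map_tauProd (h : IsSimple hmn ω ⟨m, hmn⟩ σ) (l : Fin m)
    (hl : (l : ℕ) + 1 = m) :
    tvar (l.castLE hmn.le) / tvar ⟨m, hmn⟩ * σ (tauProd hmn) = tauProd hmn := by
  have hm : 1 ≤ ((⟨m, hmn⟩ : Fin n) : ℕ) := by simp; omega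
  rw [h.map_tauProd hm, tauProd, ← Finset.mul_prod_erase _ _ (Finset.mem_univ l),
    ← Finset.mul_prod_erase _ (fun b : Fin m => (tvar (b.castLE hmn.le) : RatField m n))
      (Finset.mem_univ l), swap_castLE_last hmn l hl,
    div_mul_mul_cancel_of_ne' (tvar_ne_zero _)]
  congr 1
  refine Finset.prod_congr rfl fun b hb => congrArg tvar ?_
  have hbl := Fin.val_ne_of_ne (Finset.ne_of_mem_erase hb)
  exact swap_castLE_of_ne (i := (⟨m, hmn⟩ : Fin n)) hmn b (by simp; omega) (by simp; omega)

theorem mul_mul_add_eq {F : Type*} [Field F] {t S P c₁ c₂ f g : F} (h : t * S = P) :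
    t * (c₁ * f + c₂ * g) * S = c₁ * (f * P) + c₂ * (g * P) := by
  rw [← h]
  ring

theorem IsSimple.on_f_mid_last (h : IsSimple hmn ω ⟨m, hmn⟩ σ) (l : Fin m)
    (hl : (l : ℕ) + 1 = m) : ∃ r : Fin m → Mero n,
      σ (fvar l * tauProd hmn) = ∑ b, meroCoeff m n (r b) * (fvar b * tauProd hmn) ∧
      ∀ x, σ (coeff m (basisTheta hmn ω x l)) =
        ∑ b, meroCoeff m n (r b) * coeff m (basisTheta hmn ω x b) := by
  have hm : 1 ≤ ((⟨m, hmn⟩ : Fin n) : ℕ) := by simp; omega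
  refine ⟨Pi.single l 1, ?_, fun x => ?_⟩
  · rw [sum_single_mul _ fun b => fvar b * tauProd hmn, map_mul, h.f_mid_last rfl _ hl,
      mul_right_comm, h.mid_map_tauProd l hl, mul_comm]
  · rw [sum_single_mul _ fun b => coeff m (basisTheta hmn ω x b), h.map_basisTheta hm,
      refl_mid_root_zero hmn l hl]
    congr 1
    refine Finset.prod_congr rfl fun b _ => ?_
    by_cases hb : b = l
    -- The distinguished argument `ε_m + α_0` is invariant: `ε_{m+1} + (α_0 + ε_m - ε_{m+1}) = ε_m +
    -- α_0`.
    · rw [if_pos hb, if_pos hb, hb, swap_castLE_last hmn l hl]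
      congr 1
      abel
    · have hbl := Fin.val_ne_of_ne hb
      rw [if_neg hb, if_neg hb, swap_castLE_of_ne (i := (⟨m, hmn⟩ : Fin n)) hmn b (by simp; omega)
        (by simp; omega)]

set_option maxHeartbeats 1000000 in
-- Only the factors with index `a` and `l` differ among the three theta products; the others form
-- the common factor `R`. What remains is the three-term identity with `w = ε_{m+1}`.
theorem IsSimple.map_basisTheta_mid (h : IsSimple hmn ω ⟨m, hmn⟩ σ) (x : ℂ) (a l : Fin m)
    (ha : (a : ℕ) + 1 < m) (hl : (l : ℕ) + 1 = m) :
    σ (coeff m (basisTheta hmn ω x a)) = cc hmn ω a l * coeff m (basisTheta hmn ω x a) +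
      cc hmn ω l a * coeff m (basisTheta hmn ω x l) := by
  have hm : 1 ≤ ((⟨m, hmn⟩ : Fin n) : ℕ) := by simp; omega
  have hal : a ≠ l := fun h => by
    have := congrArg Fin.val h
    omega
  have huv : (pt (a.castLE hmn.le) - pt (l.castLE hmn.le) : Lat n) ≠ 0 :=
    pt_sub_pt_ne_zero fun hab => hal (Fin.castLE_injective hmn.le hab)
  have hs : ∀ b : Fin m, b ≠ l →
      Equiv.swap (⟨m - 1, by omega⟩ : Fin n) ⟨m, hmn⟩ (b.castLE hmn.le) = b.castLE hmn.le := by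
    intro b hb
    have hbl := Fin.val_ne_of_ne hb
    exact swap_castLE_of_ne (i := (⟨m, hmn⟩ : Fin n)) hmn b (by simp; omega) (by simp; omega)
  let R : Entire n := ∏ b ∈ (Finset.univ.erase a).erase l,
    shiftedBracket ω x (pt (b.castLE hmn.le) : Lat n)
  have hR : ∀ (c : Fin m) (A : Lat n), c = a ∨ c = l → ∏ b ∈ (Finset.univ.erase a).erase l,
      shiftedBracket ω x (pt (b.castLE hmn.le) + if b = c then A else 0) = R := by
    intro c A hc
    refine Finset.prod_congr rfl fun b hb => ?_
    rw [Finset.mem_erase, Finset.mem_erase] at hb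
    rw [if_neg, add_zero]
    rintro rfl
    tauto
  have hR' : ∀ A : Lat n, ∏ b ∈ (Finset.univ.erase a).erase l, shiftedBracket ω x
      (pt (Equiv.swap (⟨m - 1, by omega⟩ : Fin n) ⟨m, hmn⟩ (b.castLE hmn.le)) +
        if b = a then A else 0) = R := by
    intro A
    rw [← hR a A (Or.inl rfl)]
    refine Finset.prod_congr rfl fun b hb => ?_
    rw [hs b (Finset.ne_of_mem_erase hb)]
  have e0 := coeff_shiftedBracket_three_term (m := m) ω x (w := pt ⟨m, hmn⟩) huv
    (root_zero_ne_zero (n := n) m ⟨0, by omega⟩ rfl)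
  have e1 : σ (coeff m (basisTheta hmn ω x a)) =
      coeffHom m n (shiftedBracket ω x (pt (a.castLE hmn.le) + (root m (⟨0, by omega⟩ : Fin n) +
        (pt (l.castLE hmn.le) - pt ⟨m, hmn⟩))) * shiftedBracket ω x (pt ⟨m, hmn⟩) ) *
          coeffHom m n R := by
    rw [h.map_basisTheta hm, prod_eq_mul_mul_prod_erase hal, hR', if_pos rfl, if_neg hal.symm,
      refl_mid_root_zero hmn l hl, swap_castLE_last hmn l hl, hs a hal, add_zero, coeff_eq, map_mul]
  have e2 : coeff m (basisTheta hmn ω x a) =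
      coeffHom m n (shiftedBracket ω x (pt (a.castLE hmn.le) + root m (⟨0, by omega⟩ : Fin n)) *
        shiftedBracket ω x (pt (l.castLE hmn.le))) * coeffHom m n R := by
    rw [basisTheta, prod_eq_mul_mul_prod_erase hal, hR a _ (Or.inl rfl), if_pos rfl,
      if_neg hal.symm, add_zero, coeff_eq, map_mul]
  have e3 : coeff m (basisTheta hmn ω x l) =
      coeffHom m n (shiftedBracket ω x (pt (l.castLE hmn.le) + root m (⟨0, by omega⟩ : Fin n)) *
        shiftedBracket ω x (pt (a.castLE hmn.le))) * coeffHom m n R := by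
    rw [basisTheta, prod_eq_mul_mul_prod_erase hal.symm, Finset.erase_right_comm,
      hR l _ (Or.inr rfl), if_pos rfl, if_neg hal, add_zero, coeff_eq, map_mul]
  rw [e1, e2, e3, ← mul_assoc, ← mul_assoc, ← add_mul]
  exact congrArg (· * coeffHom m n R) e0

theorem IsSimple.on_f_mid (h : IsSimple hmn ω ⟨m, hmn⟩ σ) (a l : Fin m)
    (ha : (a : ℕ) + 1 < m) (hl : (l : ℕ) + 1 = m) : ∃ r : Fin m → Mero n,
      σ (fvar a * tauProd hmn) = ∑ b, meroCoeff m n (r b) * (fvar b * tauProd hmn) ∧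
      ∀ x, σ (coeff m (basisTheta hmn ω x a)) =
        ∑ b, meroCoeff m n (r b) * coeff m (basisTheta hmn ω x b) := by
  have hal : a ≠ l := fun h => by
    have := congrArg Fin.val h
    omega
  obtain ⟨c₁, hc₁, -⟩ := meroCoeff_ratio m ω (pt (a.castLE hmn.le) : Lat n)
    (pt (l.castLE hmn.le)) (pt ⟨m, hmn⟩) (root m ⟨0, by omega⟩)
  obtain ⟨c₂, hc₂, -⟩ := meroCoeff_ratio m ω (pt (l.castLE hmn.le) : Lat n)
    (pt (a.castLE hmn.le)) (pt ⟨m, hmn⟩) (root m ⟨0, by omega⟩)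
  refine ⟨fun b => if b = a then c₁ else if b = l then c₂ else 0, ?_, fun x => ?_⟩
  · rw [sum_ite_mul hal c₁ c₂ fun b => fvar b * tauProd hmn, map_mul, h.f_mid rfl a l ha hl, hc₁,
      hc₂]
    exact mul_mul_add_eq (h.mid_map_tauProd l hl)
  · rw [sum_ite_mul hal c₁ c₂ fun b => coeff m (basisTheta hmn ω x b),
      h.map_basisTheta_mid x a l ha hl, hc₁, hc₂]
    rfl

theorem IsSimple.isCompatible (h : IsSimple hmn ω i σ) (hi : 1 ≤ (i : ℕ)) :
    IsCompatible hmn ω σ (refl m i) where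
  on_coeff := h.on_coeff
  on_tau a := ⟨_, refl_pos_pt m i a hi, h.tau hi a⟩
  on_f a := by
    rcases lt_trichotomy (i : ℕ) m with him | him | him
    · exact h.on_f_lt hi him a
    · obtain rfl : i = ⟨m, hmn⟩ := Fin.ext him
      by_cases ha : (a : ℕ) + 1 < m
      · exact h.on_f_mid a ⟨m - 1, Nat.sub_lt hi Nat.one_pos⟩ ha (Nat.sub_add_cancel hi)
      · exact h.on_f_mid_last a (by omega)
    · exact h.on_f_gt him a

end OnF

end

end EllipticTau
namespace EllipticTau

noncomputable section

attribute [local instance] ratField_nontrivial ratFieldField ratField_neZero_one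

/-! ### The relations with the reflection `s₀` -/

/-- The effect of `s_0` on `c_{a,b}`: it adds `α_0` to `ε_a` and `ε_b`, fixes `ε_{m+1}` and negates
`α_0`. The numerator becomes that of `c_{b,a}`, and the sign of `[-α_0]` turns `[ε_a - ε_b]` into
`[ε_b - ε_a]`. -/
theorem ratio_refl_zero (m : ℕ) {n : ℕ} (ω : UpperHalfPlane) (u v w A : Lat n) :
    ratio m ω (u + A) (v + A) w (-A) = ratio m ω v u w A := by
  rw [ratio, ratio, show -A + (v + A) - w = v - w by abel, show u + A - w = A + u - w by abel,
    show u + A - (v + A) = -(v - u) by abel, br_neg, br_neg, neg_mul_neg, mul_comm (br m ω (v - w))]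

section ZeroRelations

variable {m n : ℕ} {hmn : m < n} {ω : UpperHalfPlane} {z : Fin n}
  {σ₀ σ : RatField m n ≃+* RatField m n}

theorem IsSimple.zero_tau' (h₀ : IsSimple hmn ω z σ₀) (hz : (z : ℕ) = 0) (a : Fin n)
    (ha : (a : ℕ) < m) : σ₀ (tvar a) = fvar ⟨a, ha⟩ * tvar a := h₀.zero_tau hz ⟨a, ha⟩

theorem IsSimple.zero_cc (h₀ : IsSimple hmn ω z σ₀) (hz : (z : ℕ) = 0) (a b : Fin m) :
    σ₀ (cc hmn ω a b) = cc hmn ω b a := by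
  have hz' : z = ⟨0, by omega⟩ := Fin.ext hz
  have hp : ∀ a : Fin m, refl m z (pt (a.castLE hmn.le) : Lat n) =
      pt (a.castLE hmn.le) + root m z := fun a =>
    (refl_zero_pt m z _ hz).trans (if_pos a.2)
  have hw : refl m z (pt ⟨m, hmn⟩ : Lat n) = pt ⟨m, hmn⟩ :=
    (refl_zero_pt m z _ hz).trans (if_neg (lt_irrefl m))
  rw [cc_eq_ratio, cc_eq_ratio, ← hz', map_ratio h₀.on_coeff, hp, hp, hw, refl_root_self m hmn]
  exact ratio_refl_zero m ω _ _ _ _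

/-- Both `R` and its inverse fix `τ_a`, so `R` fixes `s_0(τ_a) = f_a τ_a` and hence `f_a`. This
spares any verification of the relations on the `f_a`. -/
theorem eq_one_of_conj_eq_inv (h₀ : IsSimple hmn ω z σ₀) (hz : (z : ℕ) = 0)
    {R : RatField m n ≃+* RatField m n} (hc : ∀ g, R (coeff m g) = coeff m g)
    (ht : ∀ a, R (tvar a) = tvar a) (hR : R * σ₀ = σ₀ * R⁻¹) : R = 1 := by
  refine ringEquiv_ext hc (fun a => ?_) ht
  have h1 := RingEquiv.congr_fun hR (tvar (a.castLE hmn.le))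
  have h2 : R⁻¹ (tvar (a.castLE hmn.le)) = tvar (a.castLE hmn.le) := by
    have h3 := congrArg (R⁻¹ : RatField m n ≃+* RatField m n) (ht (a.castLE hmn.le))
    exact h3.symm.trans (R.symm_apply_apply _)
  change R (σ₀ _) = σ₀ (R⁻¹ _) at h1
  rw [h2, h₀.zero_tau hz, map_mul, ht] at h1
  exact mul_right_cancel₀ (tvar_ne_zero _) h1

theorem mul_pow_eq_one_comm {G : Type*} [Group G] {a b : G} (ha : a * a = 1) (hb : b * b = 1)
    {k : ℕ} (h : (a * b) ^ k = 1) : (b * a) ^ k = 1 := by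
  have h1 : b * a = (a * b)⁻¹ := by
    rw [mul_inv_rev, inv_eq_of_mul_eq_one_left ha, inv_eq_of_mul_eq_one_left hb]
  rw [h1, inv_pow, h, inv_one]

/-- Conjugation by the involution `a` turns `a * b` into `b * a`, its inverse. -/
theorem pow_mul_eq_mul_inv_pow {G : Type*} [Group G] {a b : G} (ha : a * a = 1) (hb : b * b = 1)
    (k : ℕ) : (a * b) ^ k * a = a * ((a * b) ^ k)⁻¹ := by
  have h1 : a⁻¹ = a := inv_eq_of_mul_eq_one_left ha
  have h2 : b⁻¹ = b := inv_eq_of_mul_eq_one_left hb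
  have h3 : a * b = a * (a * b)⁻¹ * a⁻¹ := by
    rw [mul_inv_rev, h1, h2, ← mul_assoc, mul_assoc, ha, mul_one]
  conv_lhs => rw [h3, conj_pow, inv_mul_cancel_right, inv_pow]

theorem IsSimple.zero_comm_tau (h₀ : IsSimple hmn ω z σ₀) (hz : (z : ℕ) = 0) {i : Fin n}
    (h : IsSimple hmn ω i σ) (hi : 1 ≤ (i : ℕ)) (him : (i : ℕ) ≠ m) (a : Fin n) :
    σ₀ (σ (tvar a)) = σ (σ₀ (tvar a)) := by
  rw [h.tau hi]
  by_cases ha : (a : ℕ) < m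
  · rcases Nat.lt_or_gt_of_ne him with him | him
    · have hs := swap_castLE_of_lt hmn him ⟨a, ha⟩
      change Equiv.swap (⟨i - 1, by omega⟩ : Fin n) i a = _ at hs
      rw [h₀.zero_tau' hz a ha, map_mul, h.tau hi, h.f_lt hi him, hs]
      exact h₀.zero_tau hz _
    · have hs := swap_castLE_of_ne (i := i) hmn ⟨a, ha⟩ (by simp; omega) (by simp; omega)
      change Equiv.swap (⟨i - 1, by omega⟩ : Fin n) i a = a at hs
      rw [hs, h₀.zero_tau' hz a ha, map_mul, h.tau hi, h.f_gt him, hs]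
  · rw [h₀.zero_tau_fix hz a (by omega), h.tau hi]
    refine h₀.zero_tau_fix hz _ ?_
    rw [Equiv.swap_apply_def]
    split_ifs with h1 h2
    · rw [h1] at ha
      simp only at ha
      omega
    · rw [h2] at ha
      simp only
      omega
    · omega

/-- Here `f = f_a`, `g = f_m`, `s = τ_m`, `t = τ_{m+1}`, `u = τ_a`. Since `u` is fixed by `s_m`, the
claim is that `s_m s_0 u = (s / t) (c f + d g) u` is fixed by `s_0`. This holds because `s_0`
exchanges `c` and `d`, inverts `f` and `g`, and multiplies `s` by `g` and `u` by `f`. -/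
theorem braid_of_mid_formulas {F : Type*} [Field F] {σ₀ σ : F ≃+* F} {f g s t u c d : F}
    (hf : f ≠ 0) (hg : g ≠ 0) (h0s : σ₀ s = g * s) (h0t : σ₀ t = t) (h0u : σ₀ u = f * u)
    (h0f : σ₀ f = 1 / f) (h0g : σ₀ g = 1 / g) (h0c : σ₀ c = d) (h0d : σ₀ d = c) (hu : σ u = u)
    (hσf : σ f = s / t * (c * f + d * g)) : σ₀ (σ (σ₀ u)) = σ (σ₀ (σ u)) := by
  rw [hu, h0u, map_mul, hu, hσf, map_mul, map_mul, map_div₀, map_add, map_mul, map_mul, h0s, h0t,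
    h0u, h0f, h0g, h0c, h0d]
  field_simp
  ring

/-- The element `f_m τ_m` is fixed by `s_m`, and `s_0` exchanges it with `τ_m`. -/
theorem braid_of_last_formulas {F : Type*} [Field F] {σ₀ σ : F ≃+* F} {g s t : F}
    (hg : g ≠ 0) (ht : t ≠ 0) (h0s : σ₀ s = g * s) (h0t : σ₀ t = t) (h0g : σ₀ g = 1 / g)
    (hs : σ s = t) (hσt : σ t = s) (hσg : σ g = s / t * g) :
    σ₀ (σ (σ₀ s)) = σ (σ₀ (σ s)) ∧ σ₀ (σ (σ₀ t)) = σ (σ₀ (σ t)) := by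
  have h1 : σ (g * s) = g * s := by
    rw [map_mul, hσg, hs]
    field_simp
  have h2 : σ₀ (g * s) = s := by
    rw [map_mul, h0g, h0s]
    field_simp
  constructor
  · rw [h0s, h1, h2, hs, h0t, hσt]
  · rw [h0t, hσt, h0s, h1]

theorem IsSimple.zero_mid_braid_tau (h₀ : IsSimple hmn ω z σ₀) (hz : (z : ℕ) = 0)
    (h : IsSimple hmn ω ⟨m, hmn⟩ σ) (hm : 1 ≤ m) (a : Fin n) :
    σ₀ (σ (σ₀ (tvar a))) = σ (σ₀ (σ (tvar a))) := by
  let l : Fin m := ⟨m - 1, Nat.sub_lt hm Nat.one_pos⟩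
  have hl : (l : ℕ) + 1 = m := Nat.sub_add_cancel hm
  have hwm : σ₀ (tvar ⟨m, hmn⟩) = tvar ⟨m, hmn⟩ := h₀.zero_tau_fix hz _ le_rfl
  have htl : σ (tvar (l.castLE hmn.le)) = tvar ⟨m, hmn⟩ :=
    (h.tau hm _).trans (congrArg tvar (swap_castLE_last hmn l hl))
  have htm : σ (tvar ⟨m, hmn⟩) = tvar (l.castLE hmn.le) := by
    rw [h.tau hm, Equiv.swap_apply_right]
    rfl
  have hlast := braid_of_last_formulas (fvar_ne_zero l) (tvar_ne_zero _) (h₀.zero_tau hz l) hwm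
    (h₀.zero_f hz l) htl htm (h.f_mid_last rfl l hl)
  rcases lt_trichotomy (a : ℕ) m with ha | ha | ha
  · obtain ⟨b, rfl⟩ : ∃ b : Fin m, a = b.castLE hmn.le := ⟨⟨a, ha⟩, rfl⟩
    by_cases hb : (b : ℕ) + 1 < m
    · have htb : σ (tvar (b.castLE hmn.le)) = tvar (b.castLE hmn.le) :=
        (h.tau hm _).trans (congrArg tvar
          (swap_castLE_of_ne (i := (⟨m, hmn⟩ : Fin n)) hmn b (by simp; omega) (by simp; omega)))
      exact braid_of_mid_formulas (fvar_ne_zero b) (fvar_ne_zero l) (h₀.zero_tau hz l) hwm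
        (h₀.zero_tau hz b) (h₀.zero_f hz b) (h₀.zero_f hz l) (h₀.zero_cc hz b l)
        (h₀.zero_cc hz l b) htb (h.f_mid rfl b l hb hl)
    · obtain rfl : b = l := Fin.ext (by omega)
      exact hlast.1
  · obtain rfl : a = ⟨m, hmn⟩ := Fin.ext ha
    exact hlast.2
  · have hta : σ (tvar a) = tvar a := by
      rw [h.tau hm, Equiv.swap_apply_of_ne_of_ne]
      · rintro rfl
        simp only at ha
        omega
      · rintro rfl
        exact lt_irrefl _ ha
    have h0a := h₀.zero_tau_fix hz a ha.le
    rw [hta, h0a, hta, h0a]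

end ZeroRelations

/-! ### Existence and uniqueness of the action -/

theorem on_coeff_pow {m n : ℕ} {σ : RatField m n ≃+* RatField m n} {T : Module.End ℤ (Lat n)}
    (h : ∀ g, σ (coeff m g) = coeff m (pullback T g)) (k : ℕ) (g : Entire n) :
    (σ ^ k) (coeff m g) = coeff m (pullback (T ^ k) g) := by
  induction k generalizing g with
  | zero => rw [pow_zero, pow_zero, pullback_one]; rfl
  | succ k ih => rw [pow_succ, pow_succ]; exact on_coeff_mul ih h g

theorem cox_apply_zero {m n : ℕ} {z j : Fin n} (hz : (z : ℕ) = 0) (hj : 1 ≤ (j : ℕ)) :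
    (cox m n).M z j = if (j : ℕ) = m then 3 else 2 := by
  have hne : z ≠ j := by rintro rfl; omega
  have hA : Adjacent m z j ↔ (j : ℕ) = m := by unfold Adjacent; omega
  change (if z = j then 1 else if Adjacent m z j then 3 else 2) = _
  rw [if_neg hne, if_congr hA rfl rfl]

theorem zero_relation {m n : ℕ} {hmn : m < n} {ω : UpperHalfPlane} {z j : Fin n}
    {σ₀ σ : RatField m n ≃+* RatField m n} (hz : (z : ℕ) = 0) (hj : 1 ≤ (j : ℕ))
    (h₀ : IsSimple hmn ω z σ₀) (h : IsSimple hmn ω j σ) (h₀₀ : σ₀ * σ₀ = 1) (hh : σ * σ = 1) :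
    (σ₀ * σ) ^ (cox m n).M z j = 1 := by
  have i0 : ∀ x, σ₀ (σ₀ x) = x := RingEquiv.congr_fun h₀₀
  have i1 : ∀ x, σ (σ x) = x := RingEquiv.congr_fun hh
  refine eq_one_of_conj_eq_inv h₀ hz (fun g => ?_) (fun a => ?_) (pow_mul_eq_mul_inv_pow h₀₀ hh _)
  · rw [on_coeff_pow (on_coeff_mul h₀.on_coeff h.on_coeff)]
    congr 1
    exact (congrArg (fun T => pullback T g) (refl_liftable m hmn z j)).trans (pullback_one g)
  · rw [cox_apply_zero hz hj]
    split_ifs with hjm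
    · obtain rfl : j = ⟨m, hmn⟩ := Fin.ext hjm
      have hb := h₀.zero_mid_braid_tau hz h hj a
      change σ₀ (σ (σ₀ (σ (σ₀ (σ (tvar a)))))) = tvar a
      rw [← hb, i0, i1, i0]
    · have hb := h₀.zero_comm_tau hz h hj hjm a
      change σ₀ (σ (σ₀ (σ (tvar a)))) = tvar a
      rw [hb, i1, i0]

set_option maxHeartbeats 1000000 in
theorem isLiftable_of_isSimple {m n : ℕ} {hmn : m < n} {ω : UpperHalfPlane}
    {σ : Fin n → (RatField m n ≃+* RatField m n)} (h : ∀ i, IsSimple hmn ω i (σ i))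
    (hh : ∀ i, σ i * σ i = 1) : (cox m n).IsLiftable σ := by
  intro i j
  rcases Nat.eq_zero_or_pos i with hi | hi
  · rcases Nat.eq_zero_or_pos j with hj | hj
    · obtain rfl : i = j := Fin.ext (by omega)
      rw [(cox m n).diagonal]
      exact (pow_one _).trans (hh i)
    · exact zero_relation hi hj (h i) (h j) (hh i) (hh j)
  · rcases Nat.eq_zero_or_pos j with hj | hj
    · have hM : (cox m n).M i j = (cox m n).M j i := (cox m n).symmetric i j
      rw [hM]
      have hR := zero_relation hj hi (h j) (h i) (hh j) (hh i)
      exact mul_pow_eq_one_comm (a := σ j) (b := σ i) (hh j) (hh i) hR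
    · have h1 := (((h i).isCompatible hi).mul ((h j).isCompatible hj)).pow ((cox m n).M i j)
      rw [refl_liftable m hmn i j] at h1
      exact h1.eq_one

theorem existsUnique_isBirationalAction {m n : ℕ} (hm : 0 < m) (hmn : m < n)
    (ω : UpperHalfPlane) :
    ∃! ρ : Weyl m n →* (RatField m n ≃+* RatField m n), IsBirationalAction hmn ω ρ := by
  choose σ h hh using exists_isSimple hm hmn ω
  have hl := isLiftable_of_isSimple h fun i => RingEquiv.ext (hh i)
  refine ⟨(cs m n).lift ⟨σ, hl⟩, fun i => ?_, fun ρ hρ => ?_⟩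
  · rw [(cs m n).lift_apply_simple hl]
    exact h i
  · refine (cs m n).ext_simple fun i => ?_
    rw [(cs m n).lift_apply_simple hl]
    exact isSimple_unique hmn ω i (hρ i) (h i)

end

end EllipticTau
namespace EllipticTau

noncomputable section

/-! ### Positivity of roots and the stabilizer of an antidominant vector -/

section Positivity

variable {m n : ℕ} (hmn : m < n)

theorem latAction_simple (i : Fin n) : latAction m hmn ((cs m n).simple i) = refl m i :=
  (cs m n).lift_apply_simple (refl_liftable m hmn) i

theorem latAction_mul_apply (w w' : Weyl m n) (x : Lat n) :
    latAction m hmn (w * w') x = latAction m hmn w (latAction m hmn w' x) := by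
  rw [map_mul]
  rfl

theorem latAction_mul_simple_apply (w : Weyl m n) (i : Fin n) (x : Lat n) :
    latAction m hmn (w * (cs m n).simple i) x = latAction m hmn w (refl m i x) := by
  rw [latAction_mul_apply, latAction_simple]

theorem metric_sub_left (x y z : Lat n) :
    metric m (x - y) z = metric m x z - metric m y z := by
  rw [metric_comm, metric_sub, metric_comm m z, metric_comm m z]

theorem metric_smul_left (c : ℤ) (x y : Lat n) : metric m (c • x) y = c * metric m x y := by
  rw [metric_comm, metric_smul, metric_comm m y]

theorem metric_refl_refl (hmn : m < n) (i : Fin n) (x y : Lat n) :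
    metric m (refl m i x) (refl m i y) = metric m x y := by
  have h := metric_root m hmn i i
  rw [if_pos rfl] at h
  rw [refl_apply, refl_apply, metric_sub, metric_smul, metric_sub_left, metric_sub_left,
    metric_smul_left, metric_smul_left, h, metric_comm m x (root m i)]
  ring

theorem metric_latAction (w : Weyl m n) (x y : Lat n) :
    metric m (latAction m hmn w x) (latAction m hmn w y) = metric m x y := by
  induction w using (cs m n).simple_induction generalizing x y with
  | simple i => rw [latAction_simple, metric_refl_refl hmn]
  | one => rw [map_one]; rfl
  | mul w w' h h' => rw [latAction_mul_apply, latAction_mul_apply, h, h']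

theorem refl_root_of_adjacent (hmn : m < n) {i j : Fin n} (hij : j ≠ i) (h : Adjacent m j i) :
    refl m j (root m i) = root m i + root m j := by
  rw [refl_apply, metric_root m hmn, if_neg hij, if_pos h, neg_smul, one_smul, sub_neg_eq_add]

theorem refl_root_of_not_adjacent (hmn : m < n) {i j : Fin n} (hij : j ≠ i) (h : ¬ Adjacent m j i) :
    refl m j (root m i) = root m i := by
  rw [refl_apply, metric_root m hmn, if_neg hij, if_neg h, zero_smul, sub_zero]

theorem cox_apply {i j : Fin n} (hij : i ≠ j) :
    (cox m n).M i j = if Adjacent m i j then 3 else 2 :=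
  if_neg hij

theorem simple_comm_of_not_adjacent {i j : Fin n} (hij : i ≠ j) (h : ¬ Adjacent m i j) :
    (cs m n).simple i * (cs m n).simple j = (cs m n).simple j * (cs m n).simple i := by
  have h1 := (cs m n).simple_mul_simple_pow i j
  rw [cox_apply hij, if_neg h, pow_two] at h1
  have h2 := eq_inv_of_mul_eq_one_left h1
  rwa [mul_inv_rev, (cs m n).inv_simple, (cs m n).inv_simple] at h2

theorem simple_braid_of_adjacent {i j : Fin n} (hij : i ≠ j) (h : Adjacent m i j) :
    (cs m n).simple i * (cs m n).simple j * (cs m n).simple i =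
      (cs m n).simple j * (cs m n).simple i * (cs m n).simple j := by
  have h1 := (cs m n).simple_mul_simple_pow i j
  rw [cox_apply hij, if_pos h, pow_succ, pow_two] at h1
  have h2 : (cs m n).simple i * (cs m n).simple j * (cs m n).simple i *
      ((cs m n).simple j * (cs m n).simple i * (cs m n).simple j) = 1 := by
    rw [← h1]
    simp only [mul_assoc]
  have h3 := eq_inv_of_mul_eq_one_left h2
  rwa [mul_inv_rev, mul_inv_rev, (cs m n).inv_simple, (cs m n).inv_simple, ← mul_assoc] at h3

/-- The nonnegative combinations of simple roots. -/
def rootCone (m n : ℕ) : AddSubmonoid (Lat n) := AddSubmonoid.closure (Set.range (root m))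

theorem root_mem_rootCone (i : Fin n) : root m i ∈ rootCone m n :=
  AddSubmonoid.subset_closure ⟨i, rfl⟩

/-- Strong induction on length, writing `w = u s_j` with `u` shorter. Applying `s_j` to `α_i` gives
`α_i` or `α_i + α_j`, and the length hypotheses for `u`, or for `v` when `u = v s_i`, follow from
the rank-two relation between `s_i` and `s_j`. -/
theorem latAction_root_mem_rootCone (w : Weyl m n) (i : Fin n)
    (h : (cs m n).length w < (cs m n).length (w * (cs m n).simple i)) :
    latAction m hmn w (root m i) ∈ rootCone m n := by
  induction hk : (cs m n).length w using Nat.strong_induction_on generalizing w i with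
  | _ k ih =>
    subst hk
    by_cases hw : w = 1
    · rw [hw, map_one]
      exact root_mem_rootCone i
    obtain ⟨j, hj⟩ := (cs m n).exists_rightDescent_of_ne_one hw
    rw [(cs m n).isRightDescent_iff] at hj
    obtain ⟨u, rfl⟩ : ∃ u, w = u * (cs m n).simple j :=
      ⟨w * (cs m n).simple j, ((cs m n).simple_mul_simple_cancel_right j).symm⟩
    rw [(cs m n).simple_mul_simple_cancel_right] at hj
    have hij : j ≠ i := by
      rintro rfl
      rw [(cs m n).simple_mul_simple_cancel_right] at h
      omega
    have hle : ∀ (v : Weyl m n) (l : Fin n),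
        (cs m n).length (v * (cs m n).simple l) ≤ (cs m n).length v + 1 := fun v l =>
      ((cs m n).length_mul_le v _).trans (by rw [(cs m n).length_simple])
    rw [latAction_mul_simple_apply]
    by_cases hA : Adjacent m j i
    · rw [refl_root_of_adjacent hmn hij hA]
      rcases (cs m n).length_mul_simple u i with hu | hu
      · rw [map_add]
        exact add_mem (ih _ (by omega) u i (by omega) rfl) (ih _ (by omega) u j (by omega) rfl)
      · obtain ⟨v, rfl⟩ : ∃ v, u = v * (cs m n).simple i :=
          ⟨u * (cs m n).simple i, ((cs m n).simple_mul_simple_cancel_right i).symm⟩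
        rw [(cs m n).simple_mul_simple_cancel_right] at hu
        have hA' : Adjacent m i j := by unfold Adjacent at hA ⊢; tauto
        rw [latAction_mul_simple_apply, map_add, refl_root_self m hmn,
          refl_root_of_adjacent hmn hij.symm hA', neg_add_eq_sub, add_sub_cancel_right]
        refine ih _ (by omega) v j ?_ rfl
        rcases (cs m n).length_mul_simple v j with hv | hv
        · omega
        -- If `v s_j` were shorter than `v`, then `w s_i = v s_j s_i s_j` would have length at most
        -- one more than `v`, although `w` is two longer than `v`.
        · exfalso
          have e1 : v * (cs m n).simple i * (cs m n).simple j * (cs m n).simple i =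
              v * (cs m n).simple j * (cs m n).simple i * (cs m n).simple j := by
            have := congrArg (v * ·) (simple_braid_of_adjacent hij.symm hA')
            simpa only [mul_assoc] using this
          have e2 := hle (v * (cs m n).simple j * (cs m n).simple i) j
          have e3 := hle (v * (cs m n).simple j) i
          rw [e1] at h
          omega
    · rw [refl_root_of_not_adjacent hmn hij hA]
      refine ih _ (by omega) u i ?_ rfl
      rcases (cs m n).length_mul_simple u i with hu | hu
      · omega
      -- Otherwise `w s_i = u s_i s_j` would be no longer than `u`, hence shorter than `w`.
      · exfalso
        have e1 : u * (cs m n).simple j * (cs m n).simple i =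
            u * (cs m n).simple i * (cs m n).simple j := by
          rw [mul_assoc, simple_comm_of_not_adjacent hij hA, mul_assoc]
        have e2 := hle (u * (cs m n).simple i) j
        rw [e1] at h
        omega

theorem metric_rootCone_nonpos {x y : Lat n} (hx : x ∈ rootCone m n)
    (hy : ∀ i : Fin n, metric m y (root m i) ≤ 0) : metric m y x ≤ 0 := by
  induction hx using AddSubmonoid.closure_induction with
  | mem x hx =>
    obtain ⟨i, rfl⟩ := hx
    exact hy i
  | zero => simp [metric]
  | add x x' _ _ h h' =>
    rw [metric_add]
    exact add_nonpos h h'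

/-- The stabilizer of an antidominant vector is generated by the simple reflections in it. If `w = u
s_i` fixes `y` with `u` shorter, then invariance of the metric gives `⟨y, α_i⟩ = ⟨y, w α_i⟩ = -⟨y, u
α_i⟩ ≥ 0`, because `u α_i` is positive. So `⟨y, α_i⟩ = 0`, and both `s_i` and `u` fix `y`. -/
theorem stabilizer_induction {y : Lat n} (hy : ∀ i : Fin n, metric m y (root m i) ≤ 0)
    {p : Weyl m n → Prop} (one : p 1)
    (mul : ∀ w i, metric m y (root m i) = 0 → p w → p (w * (cs m n).simple i))
    (w : Weyl m n) (hw : latAction m hmn w y = y) : p w := by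
  induction hk : (cs m n).length w using Nat.strong_induction_on generalizing w with
  | _ k ih =>
    subst hk
    by_cases hw1 : w = 1
    · rw [hw1]
      exact one
    obtain ⟨i, hi⟩ := (cs m n).exists_rightDescent_of_ne_one hw1
    rw [(cs m n).isRightDescent_iff] at hi
    obtain ⟨u, rfl⟩ : ∃ u, w = u * (cs m n).simple i :=
      ⟨w * (cs m n).simple i, ((cs m n).simple_mul_simple_cancel_right i).symm⟩
    rw [(cs m n).simple_mul_simple_cancel_right] at hi
    have h1 := metric_rootCone_nonpos
      (latAction_root_mem_rootCone hmn u i (by omega)) hy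
    have h2 := metric_latAction hmn (u * (cs m n).simple i) y (root m i)
    rw [hw, latAction_mul_simple_apply, refl_root_self m hmn, map_neg, ← zero_sub, metric_sub]
      at h2
    have h3 : metric m y (0 : Lat n) = 0 := by simp [metric]
    have h4 : metric m y (root m i) = 0 := by
      have := hy i
      omega
    refine mul u i h4 (ih _ (by omega) u ?_ rfl)
    rwa [latAction_mul_simple_apply, refl_apply, metric_comm, h4, zero_smul, sub_zero] at hw

end Positivity

end

end EllipticTau
namespace EllipticTau

noncomputable section

attribute [local instance] ratField_nontrivial ratFieldField ratField_neZero_one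

/-! ### Algebra for the basic bilinear relation -/

theorem root_zero_eq {m n : ℕ} (hm : 2 ≤ m) (hmn : m < n) :
    root m (⟨0, by omega⟩ : Fin n) =
      e 0 - ∑ q : Fin (m - 2), pt (⟨q, by omega⟩ : Fin n) - pt ⟨m - 2, by omega⟩ -
        pt ⟨m - 1, by omega⟩ := by
  funext b
  refine Fin.cases ?_ (fun c => ?_) b
  · rw [root_zero_apply_zero m _ rfl]
    simp [e]
  · have hs : (∑ q : Fin (m - 2), pt (⟨q, by omega⟩ : Fin n) : Lat n) c.succ =
        if (c : ℕ) < m - 2 then 1 else 0 := by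
      rw [Finset.sum_apply]
      simp only [pt_apply_succ]
      split_ifs with hc
      · rw [Finset.sum_eq_single ⟨c, hc⟩, if_pos rfl]
        · intro q _ hq
          rw [if_neg]
          rintro rfl
          exact hq rfl
        · exact fun hq => absurd (Finset.mem_univ _) hq
      · refine Finset.sum_eq_zero fun q _ => if_neg ?_
        rintro rfl
        exact hc q.2
    rw [root_zero_apply_succ m _ c rfl, Pi.sub_apply, Pi.sub_apply, Pi.sub_apply, hs,
      pt_apply_succ, pt_apply_succ]
    have h0 : (e 0 : Lat n) c.succ = 0 := Pi.single_eq_of_ne (Fin.succ_ne_zero c) 1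
    have h1 : c = ⟨m - 2, by omega⟩ ↔ (c : ℕ) = m - 2 := Fin.ext_iff
    have h2 : c = ⟨m - 1, by omega⟩ ↔ (c : ℕ) = m - 1 := Fin.ext_iff
    simp only [h0, h1, h2]
    split_ifs <;> omega

theorem three_term_of_formula {F : Type*} [Field F] {p q x y z w f g r s t X : F} (hp : p ≠ 0)
    (hq : q ≠ 0) (ht : t ≠ 0)
    (hX : X = s / t * (x * y / (p * q) * f + z * w / (-p * q) * g) * r) :
    p * q * t * X + z * w * r * (g * s) + -x * y * s * (f * r) = 0 := by
  rw [hX]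
  field_simp
  ring

theorem map_three_term {F : Type*} [Field F] (σ : F ≃+* F) {a b c d a' b' c' d' a'' b'' c'' d'' : F}
    (h : a * b * c * d + a' * b' * c' * d' + a'' * b'' * c'' * d'' = 0) :
    σ a * σ b * σ c * σ d + σ a' * σ b' * σ c' * σ d' + σ a'' * σ b'' * σ c'' * σ d'' = 0 := by
  simp only [← map_mul, ← map_add]
  rw [h, map_zero]

/-! ### The tau functions -/

section Tau

variable {m n : ℕ} {hmn : m < n} {ω : UpperHalfPlane}
  {ρ : Weyl m n →* (RatField m n ≃+* RatField m n)}

theorem map_mul_apply (w w' : Weyl m n) (x : RatField m n) : ρ (w * w') x = ρ w (ρ w' x) := by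
  rw [map_mul]
  rfl

theorem map_one_apply (x : RatField m n) : ρ 1 x = x := by
  rw [map_one]
  rfl

theorem map_eq_map_of_fixed {u v : Weyl m n} {x : RatField m n} (h : ρ (u⁻¹ * v) x = x) :
    ρ v x = ρ u x :=
  calc
    ρ v x = ρ (u * (u⁻¹ * v)) x := by rw [mul_inv_cancel_left]
    _ = ρ u (ρ (u⁻¹ * v) x) := map_mul_apply u (u⁻¹ * v) x
    _ = ρ u x := by rw [h]

theorem latAction_inv_apply (w : Weyl m n) (x : Lat n) :
    latAction m hmn w⁻¹ (latAction m hmn w x) = x := by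
  rw [← latAction_mul_apply, inv_mul_cancel, map_one]
  rfl

theorem IsBirationalAction.on_coeff (h : IsBirationalAction hmn ω ρ) (w : Weyl m n)
    (g : Entire n) : ρ w (coeff m g) = coeff m (pullback (latAction m hmn w) g) := by
  induction w using (cs m n).simple_induction generalizing g with
  | simple i => rw [latAction_simple]; exact (h i).on_coeff g
  | one =>
    rw [map_one_apply, map_one, pullback_one]
  | mul w w' hw hw' => rw [map_mul_apply, hw', hw, map_mul (latAction m hmn), pullback_mul]

theorem IsBirationalAction.map_br (h : IsBirationalAction hmn ω ρ) (w : Weyl m n) (Λ : Lat n) :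
    ρ w (br m ω Λ) = br m ω (latAction m hmn w Λ) := by
  rw [br, h.on_coeff, pullback_bracket]
  rfl

/-- The vector `e_n` is antidominant and pairs nontrivially only with `α_{n-1}`. Its stabilizer is
therefore generated by `s_0, …, s_{n-2}`, and each of these fixes `τ_n`; for `s_0` this uses `m <
n`. -/
theorem IsBirationalAction.map_tvar_last (h : IsBirationalAction hmn ω ρ) (hm : 0 < m)
    (l : Fin n) (hl : (l : ℕ) + 1 = n) (w : Weyl m n) (hw : latAction m hmn w (pt l) = pt l) :
    ρ w (tvar l) = tvar l := by
  have hroot : ∀ i : Fin n, metric m (pt l) (root m i) = if (i : ℕ) + 1 = n then -1 else 0 := by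
    intro i
    rw [metric_comm, metric_e_succ]
    rcases Nat.eq_zero_or_pos i with hi | hi
    · rw [root_zero_apply_succ m i l hi, if_neg (by omega), if_neg (by omega)]
    · rw [root_pos_apply m i (by omega), Fin.val_succ, if_neg (by omega)]
      by_cases h1 : (i : ℕ) + 1 = n
      · rw [if_pos h1, if_pos (by omega)]
        rfl
      · rw [if_neg h1, if_neg (by omega)]
        rfl
  refine stabilizer_induction hmn (y := pt l) (fun i => ?_) (p := fun w => ρ w (tvar l) = tvar l)
    (map_one_apply _) (fun w i hi ih => ?_) w hw
  · rw [hroot]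
    split_ifs <;> omega
  · rw [hroot] at hi
    have hi' : (i : ℕ) + 1 ≠ n := fun h => by
      rw [if_pos h] at hi
      omega
    rw [map_mul_apply]
    refine (congrArg (ρ w) ?_).trans ih
    rcases Nat.eq_zero_or_pos i with h0 | h0
    · exact (h i).zero_tau_fix h0 l (by omega)
    · rw [(h i).tau h0, Equiv.swap_apply_of_ne_of_ne]
      · intro hli
        have := congrArg Fin.val hli
        simp only at this
        omega
      · rintro rfl
        exact hi' hl

/-- Adjacent transpositions generate the symmetric group. The lifts serve to pass from `e_1` to
`e_n` and to reduce the bilinear relation to one choice of indices. -/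
theorem IsBirationalAction.exists_of_perm (h : IsBirationalAction hmn ω ρ)
    (π : Equiv.Perm (Fin n)) : ∃ w : Weyl m n, latAction m hmn w (e 0) = e 0 ∧
      (∀ a, latAction m hmn w (pt a) = pt (π a)) ∧ ∀ a, ρ w (tvar a) = tvar (π a) := by
  obtain ⟨k, rfl⟩ : ∃ k, n = k + 1 := ⟨n - 1, by omega⟩
  have hπ : π ∈ Submonoid.closure
      (Set.range fun i : Fin k => Equiv.swap i.castSucc i.succ) := by
    rw [Equiv.Perm.mclosure_swap_castSucc_succ]
    trivial
  induction hπ using Submonoid.closure_induction with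
  | mem π hπ =>
    obtain ⟨i, rfl⟩ := hπ
    have hi : 1 ≤ ((i.succ : Fin (k + 1)) : ℕ) := by simp
    refine ⟨(cs m (k + 1)).simple i.succ, ?_, fun a => ?_, fun a => (h i.succ).tau hi a⟩
    · rw [latAction_simple, refl_pos_e_zero m _ hi]
    · rw [latAction_simple, refl_pos_pt m _ _ hi]
      rfl
  | one => exact ⟨1, by rw [map_one]; rfl, fun a => by rw [map_one]; rfl, fun a => map_one_apply _⟩
  | mul π π' _ _ hw hw' =>
    obtain ⟨w, h1, h2, h3⟩ := hw
    obtain ⟨w', h1', h2', h3'⟩ := hw'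
    refine ⟨w * w', ?_, fun a => ?_, fun a => ?_⟩
    · rw [latAction_mul_apply, h1', h1]
    · rw [latAction_mul_apply, h2', h2]
      rfl
    · rw [map_mul_apply, h3', h3]
      rfl

set_option maxHeartbeats 1000000 in
-- A permutation `g` carrying `e_n` to `e_1` and `τ_n` to `τ_1` transports the question to the
-- stabilizer of `e_n`, where `map_tvar_last` applies.
theorem IsBirationalAction.map_tvar_eq (h : IsBirationalAction hmn ω ρ) (hm : 0 < m)
    {w w' : Weyl m n}
    (hw : latAction m hmn w (pt (first hmn)) = latAction m hmn w' (pt (first hmn))) :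
    ρ w (tvar (first hmn)) = ρ w' (tvar (first hmn)) := by
  obtain ⟨l, hl⟩ : ∃ l : Fin n, (l : ℕ) + 1 = n := ⟨⟨n - 1, by omega⟩, Nat.sub_add_cancel (by omega)⟩
  obtain ⟨g, -, h1, h2⟩ := h.exists_of_perm (Equiv.swap l (first hmn))
  have h1' := h1 l
  have h2' := h2 l
  rw [Equiv.swap_apply_left] at h1' h2'
  have hg : ∀ u : Weyl m n, latAction m hmn (u * g) (pt l) = latAction m hmn u (pt (first hmn)) :=
    fun u => by rw [latAction_mul_apply, h1']
  have hg' : ∀ u : Weyl m n, ρ (u * g) (tvar l) = ρ u (tvar (first hmn)) :=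
    fun u => (map_mul_apply u g _).trans (congrArg (ρ u) h2')
  have h3 := h.map_tvar_last hm l hl ((w' * g)⁻¹ * (w * g)) (by
    rw [latAction_mul_apply, hg, hw, ← hg, latAction_inv_apply])
  exact (hg' w).symm.trans ((map_eq_map_of_fixed h3).trans (hg' w'))

theorem IsBirationalAction.tau_latAction (h : IsBirationalAction hmn ω ρ) (hm : 0 < m)
    (w : Weyl m n) :
    tau hmn ρ (latAction m hmn w (pt (first hmn))) = ρ w (tvar (first hmn)) := by
  have ho : latAction m hmn w (pt (first hmn)) ∈ orbit m hmn := ⟨w, rfl⟩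
  rw [tau, dif_pos ho]
  exact h.map_tvar_eq hm ho.choose_spec

theorem latAction_mem_orbit {Λ : Lat n} (hΛ : Λ ∈ orbit m hmn) (w : Weyl m n) :
    latAction m hmn w Λ ∈ orbit m hmn := by
  obtain ⟨u, rfl⟩ := hΛ
  exact ⟨w * u, latAction_mul_apply hmn w u _⟩

theorem IsBirationalAction.map_tau (h : IsBirationalAction hmn ω ρ) (hm : 0 < m) (w : Weyl m n)
    {Λ : Lat n} (hΛ : Λ ∈ orbit m hmn) :
    ρ w (tau hmn ρ Λ) = tau hmn ρ (latAction m hmn w Λ) := by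
  obtain ⟨u, rfl⟩ := hΛ
  rw [← latAction_mul_apply, h.tau_latAction hm, h.tau_latAction hm, map_mul_apply]

theorem IsBirationalAction.tau_pt (h : IsBirationalAction hmn ω ρ) (hm : 0 < m) (a : Fin n) :
    pt a ∈ orbit m hmn ∧ tau hmn ρ (pt a) = tvar a := by
  obtain ⟨g, -, h1, h2⟩ := h.exists_of_perm (Equiv.swap (first hmn) a)
  have h1' := h1 (first hmn)
  have h2' := h2 (first hmn)
  rw [Equiv.swap_apply_left] at h1' h2'
  refine ⟨⟨g, h1'⟩, ?_⟩
  rw [← h1', h.tau_latAction hm, h2']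

/-! ### The bilinear relations -/

set_option maxHeartbeats 1000000 in
-- Since `α_0 = L - e_a - e_b`, the vectors `L - e_b` and `L - e_a` are `s_0 e_a` and `s_0 e_b`,
-- with tau functions `f_a τ_a` and `f_b τ_b`. Moreover `L - e_{m+1} = s_m(L - e_b)`, so its tau
-- function is `s_m(f_a) τ_a`, and the relation is the formula for `s_m(f_a)` multiplied out.
theorem IsBirationalAction.three_term_base (h : IsBirationalAction hmn ω ρ) (hm : 2 ≤ m)
    {a b : Fin m} {c : Fin n} (ha : (a : ℕ) + 1 < m) (hb : (b : ℕ) + 1 = m) (hc : (c : ℕ) = m)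
    {L : Lat n} (hL : root m (⟨0, by omega⟩ : Fin n) =
      L - pt (a.castLE hmn.le) - pt (b.castLE hmn.le)) :
    (L - pt c ∈ orbit m hmn ∧ L - pt (a.castLE hmn.le) ∈ orbit m hmn ∧
      L - pt (b.castLE hmn.le) ∈ orbit m hmn) ∧
    br m ω (pt (a.castLE hmn.le) - pt (b.castLE hmn.le)) *
        br m ω (L - pt (a.castLE hmn.le) - pt (b.castLE hmn.le)) *
        tau hmn ρ (pt c) * tau hmn ρ (L - pt c) +
      br m ω (pt (b.castLE hmn.le) - pt c) * br m ω (L - pt (b.castLE hmn.le) - pt c) *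
        tau hmn ρ (pt (a.castLE hmn.le)) * tau hmn ρ (L - pt (a.castLE hmn.le)) +
      br m ω (pt c - pt (a.castLE hmn.le)) * br m ω (L - pt c - pt (a.castLE hmn.le)) *
        tau hmn ρ (pt (b.castLE hmn.le)) * tau hmn ρ (L - pt (b.castLE hmn.le)) = 0 := by
  obtain rfl : c = ⟨m, hmn⟩ := Fin.ext hc
  have hm0 : 0 < m := by omega
  let z : Fin n := ⟨0, by omega⟩
  have hz : (z : ℕ) = 0 := rfl
  have hroot : ∀ d : Fin m, latAction m hmn ((cs m n).simple z) (pt (d.castLE hmn.le)) =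
      pt (d.castLE hmn.le) + root m z := fun d => by
    rw [latAction_simple]
    exact (refl_zero_pt m z _ hz).trans (if_pos d.2)
  have hLb : L - pt (b.castLE hmn.le) =
      latAction m hmn ((cs m n).simple z) (pt (a.castLE hmn.le)) := by
    rw [hroot, hL]
    abel
  have hLa : L - pt (a.castLE hmn.le) =
      latAction m hmn ((cs m n).simple z) (pt (b.castLE hmn.le)) := by
    rw [hroot, hL]
    abel
  have hLc : L - pt ⟨m, hmn⟩ =
      latAction m hmn ((cs m n).simple ⟨m, hmn⟩) (L - pt (b.castLE hmn.le)) := by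
    have e1 := refl_mid_root_zero hmn b hb
    have e2 : refl m ⟨m, hmn⟩ (pt (a.castLE hmn.le) : Lat n) = pt (a.castLE hmn.le) := by
      rw [refl_pos_pt m (⟨m, hmn⟩ : Fin n) _ hm0, swap_castLE_of_ne (i := (⟨m, hmn⟩ : Fin n)) hmn a
        (by simp only; omega) (by simp only; omega)]
    rw [hLb, hroot, latAction_simple, map_add, e1, e2, hL]
    abel
  have oa := (h.tau_pt hm0 (a.castLE hmn.le)).1
  have ob := (h.tau_pt hm0 (b.castLE hmn.le)).1
  have oLb : L - pt (b.castLE hmn.le) ∈ orbit m hmn := hLb ▸ latAction_mem_orbit oa _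
  have oLa : L - pt (a.castLE hmn.le) ∈ orbit m hmn := hLa ▸ latAction_mem_orbit ob _
  have oLc : L - pt ⟨m, hmn⟩ ∈ orbit m hmn := hLc ▸ latAction_mem_orbit oLb _
  refine ⟨⟨oLc, oLa, oLb⟩, ?_⟩
  have tLb : tau hmn ρ (L - pt (b.castLE hmn.le)) = fvar a * tvar (a.castLE hmn.le) := by
    rw [hLb, ← h.map_tau hm0 _ oa, (h.tau_pt hm0 _).2]
    exact (h z).zero_tau hz a
  have tLa : tau hmn ρ (L - pt (a.castLE hmn.le)) = fvar b * tvar (b.castLE hmn.le) := by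
    rw [hLa, ← h.map_tau hm0 _ ob, (h.tau_pt hm0 _).2]
    exact (h z).zero_tau hz b
  have tLc : tau hmn ρ (L - pt ⟨m, hmn⟩) = tvar (b.castLE hmn.le) / tvar ⟨m, hmn⟩ *
      (cc hmn ω a b * fvar a + cc hmn ω b a * fvar b) * tvar (a.castLE hmn.le) := by
    rw [hLc, ← h.map_tau hm0 _ oLb, tLb, map_mul, (h ⟨m, hmn⟩).f_mid rfl a b ha hb]
    congr 1
    exact ((h ⟨m, hmn⟩).tau hm0 _).trans (congrArg tvar
      (swap_castLE_of_ne (i := (⟨m, hmn⟩ : Fin n)) hmn a (by simp only; omega)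
        (by simp only; omega)))
  have hab : (pt (a.castLE hmn.le) - pt (b.castLE hmn.le) : Lat n) ≠ 0 :=
    pt_sub_pt_ne_zero fun hab => by
      have := congrArg Fin.val hab
      simp only [Fin.val_castLE] at this
      omega
  rw [(h.tau_pt hm0 _).2, (h.tau_pt hm0 _).2, (h.tau_pt hm0 _).2, tLa, tLb, ← hL,
    ← neg_sub (pt (a.castLE hmn.le)) (pt ⟨m, hmn⟩), br_neg,
    show L - pt (b.castLE hmn.le) - pt ⟨m, hmn⟩ =
      root m z + pt (a.castLE hmn.le) - pt ⟨m, hmn⟩ by rw [hL]; abel,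
    show L - pt ⟨m, hmn⟩ - pt (a.castLE hmn.le) =
      root m z + pt (b.castLE hmn.le) - pt ⟨m, hmn⟩ by rw [hL]; abel]
  refine three_term_of_formula (br_ne_zero m ω hab)
    (br_ne_zero m ω (root_zero_ne_zero (n := n) m z rfl)) (tvar_ne_zero _) ?_
  rw [tLc, cc_eq_ratio, cc_eq_ratio, ratio, ratio,
    ← neg_sub (pt (a.castLE hmn.le)) (pt (b.castLE hmn.le)), br_neg]

set_option maxHeartbeats 1000000 in
theorem IsBirationalAction.three_term (h : IsBirationalAction hmn ω ρ) (hm : 2 ≤ m)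
    {i j k : Fin n} {l : Fin (m - 2) → Fin n} (hij : i ≠ j) (hjk : j ≠ k) (hki : k ≠ i)
    (hl : Function.Injective l) (hl' : ∀ q, l q ≠ i ∧ l q ≠ j ∧ l q ≠ k) {L : Lat n}
    (hL : L = e 0 - ∑ q, pt (l q)) :
    (L - pt i ∈ orbit m hmn ∧ L - pt j ∈ orbit m hmn ∧ L - pt k ∈ orbit m hmn) ∧
    br m ω (pt j - pt k) * br m ω (L - pt j - pt k) * tau hmn ρ (pt i) * tau hmn ρ (L - pt i) +
      br m ω (pt k - pt i) * br m ω (L - pt k - pt i) * tau hmn ρ (pt j) * tau hmn ρ (L - pt j) +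
      br m ω (pt i - pt j) * br m ω (L - pt i - pt j) * tau hmn ρ (pt k) * tau hmn ρ (L - pt k) =
        0 := by
  have hm0 : 0 < m := by omega
  -- In the numbering from 1, the permutation sends `1, …, m-2` to the indices `l` and `m+1, m-1, m`
  -- to `i, j, k`.
  obtain ⟨π, hπ⟩ := Equiv.Perm.exists_extending_pair (α := Fin (m - 2) ⊕ Fin 3) (β := Fin n)
    (Sum.elim (fun q => (⟨q, by omega⟩ : Fin n)) ![⟨m, hmn⟩, ⟨m - 2, by omega⟩, ⟨m - 1, by omega⟩])
    (Sum.elim l ![i, j, k])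
    (Function.Injective.sumElim (fun q q' hq => Fin.ext (congrArg (Fin.val (n := n)) hq))
      (fun x y hxy => by
        fin_cases x <;> fin_cases y <;> simp at hxy ⊢ <;> omega)
      (fun q x => by
        have := q.2
        fin_cases x <;> simp <;> omega))
    (Function.Injective.sumElim hl
      (fun x y hxy => by
        fin_cases x <;> fin_cases y <;> simp_all)
      (fun q x => by
        have := hl' q
        fin_cases x <;> simp_all))
  have hi : π ⟨m, hmn⟩ = i := hπ (Sum.inr 0)
  have hj : π ⟨m - 2, by omega⟩ = j := hπ (Sum.inr 1)
  have hk : π ⟨m - 1, by omega⟩ = k := hπ (Sum.inr 2)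
  have hq : ∀ q : Fin (m - 2), π ⟨q, by omega⟩ = l q := fun q => hπ (Sum.inl q)
  obtain ⟨w, w0, w1, -⟩ := h.exists_of_perm π
  have base := h.three_term_base hm (a := ⟨m - 2, by omega⟩) (b := ⟨m - 1, by omega⟩)
    (c := ⟨m, hmn⟩) (by simp only; omega) (by simp only; omega) rfl (root_zero_eq hm hmn)
  have wL : latAction m hmn w (e 0 - ∑ q : Fin (m - 2), pt (⟨q, by omega⟩ : Fin n)) = L := by
    rw [hL, map_sub, w0, map_sum]
    congr 1
    exact Finset.sum_congr rfl fun q _ => by rw [w1, hq]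
  generalize e 0 - ∑ q : Fin (m - 2), pt (⟨q, by omega⟩ : Fin n) = L₀ at base wL
  have wi : latAction m hmn w (pt ⟨m, hmn⟩) = pt i := by rw [w1, hi]
  have wj : latAction m hmn w (pt ⟨m - 2, by omega⟩) = pt j := by rw [w1, hj]
  have wk : latAction m hmn w (pt ⟨m - 1, by omega⟩) = pt k := by rw [w1, hk]
  simp only [Fin.castLE_mk] at base
  obtain ⟨⟨oi, oj, ok⟩, hbase⟩ := base
  refine ⟨⟨?_, ?_, ?_⟩, ?_⟩
  · rw [← wL, ← wi, ← map_sub]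
    exact latAction_mem_orbit oi w
  · rw [← wL, ← wj, ← map_sub]
    exact latAction_mem_orbit oj w
  · rw [← wL, ← wk, ← map_sub]
    exact latAction_mem_orbit ok w
  · have := map_three_term (ρ w) hbase
    simpa only [h.map_br, h.map_tau hm0 w oi, h.map_tau hm0 w oj,
      h.map_tau hm0 w ok, h.map_tau hm0 w (h.tau_pt hm0 _).1, map_sub, wi, wj, wk, wL]
      using this

end Tau

end

end EllipticTau
open EllipticTau in
theorem mainTheorem3 (m n : ℕ) (hm : 0 < m) (hmn : m < n) (ω : UpperHalfPlane) :
    (∃! ρ : Weyl m n →* (RatField m n ≃+* RatField m n), IsBirationalAction hmn ω ρ) ∧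
    ∀ ρ : Weyl m n →* (RatField m n ≃+* RatField m n), IsBirationalAction hmn ω ρ →
      (∀ w w' : Weyl m n,
        latAction m hmn w (e (first hmn).succ) = latAction m hmn w' (e (first hmn).succ) →
          ρ w (tvar (first hmn)) = ρ w' (tvar (first hmn))) ∧
      (∀ w : Weyl m n,
        tau hmn ρ (latAction m hmn w (e (first hmn).succ)) = ρ w (tvar (first hmn))) ∧
      (∀ a : Fin n, pt a ∈ orbit m hmn ∧ tau hmn ρ (pt a) = tvar a) ∧
      (2 ≤ m → ∀ (i j k : Fin n) (l : Fin (m - 2) → Fin n),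
        i ≠ j → j ≠ k → k ≠ i → Function.Injective l →
        (∀ q, l q ≠ i ∧ l q ≠ j ∧ l q ≠ k) →
        ∀ L : Lat n, L = e 0 - ∑ q, pt (l q) →
          (L - pt i ∈ orbit m hmn ∧ L - pt j ∈ orbit m hmn ∧ L - pt k ∈ orbit m hmn) ∧
          br m ω (pt j - pt k) * br m ω (L - pt j - pt k) *
              tau hmn ρ (pt i) * tau hmn ρ (L - pt i) +
            br m ω (pt k - pt i) * br m ω (L - pt k - pt i) *
              tau hmn ρ (pt j) * tau hmn ρ (L - pt j) +
            br m ω (pt i - pt j) * br m ω (L - pt i - pt j) *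
              tau hmn ρ (pt k) * tau hmn ρ (L - pt k) = 0) :=
  ⟨existsUnique_isBirationalAction hm hmn ω, fun _ h =>
    ⟨fun _ _ => h.map_tvar_eq hm, h.tau_latAction hm, h.tau_pt hm,
      fun hm2 _ _ _ _ hij hjk hki hl hl' _ hL => h.three_term hm2 hij hjk hki hl hl' hL⟩⟩
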